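/- Let $r\ge 1$. For $\epsilon>0$ let $\mathcal C$ be the Hankel contour: the positive real axis from $+\infty$ to $\epsilon$ (top side, argument $0$), the circle of radius $\epsilon$ around $0$ (counterclockwise), and the positive real axis from $\epsilon$ to $+\infty$ (bottom side, argument $2\pi$), with $\epsilon$ sufficiently small (depending only on $r$); powers $x^{s-1}$ on $\mathcal C$ are taken with $\arg x$ running from $0$ to $2\pi$. For $\mathbf s=(s_1,\dots,s_r)\in(\mathbb C\setminus\mathbb Z)^r$ put $C(\mathbf s)=\prod_{k=1}^r\frac{1}{(e^{2\pi i s_k}-1)\Gamma(s_k)}$, and for $x_1,\dots,x_r\in\mathcal C$ put $y_j=x_j+\cdots+x_r$. The desingularized multiple zeta function $\zeta^{\mathrm{des}}_r$ is the entire continuation to $\mathbb C^r$ of $$\zeta^{\mathrm{des}}_r(\mathbf s)=\lim_{c\to1,\;c\in\mathbb R\setminus\{1\}}\frac{C(\mathbf s)}{(1-c)^r}\int_{\mathcal C^r}\prod_{j=1}^r\Bigl(\frac1{e^{y_j}-1}-\frac{c}{e^{cy_j}-1}\Bigr)\prod_{k=1}^r x_k^{s_k-1}\,dx_k\qquad(\mathbf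 s\in(\mathbb C\setminus\mathbb Z)^r).$$ For $t\in(0,1)$, the function $\mathbf s\mapsto\hat\zeta^{\mathrm{des}}_r(\mathbf s)(t)$ is the entire continuation to $\mathbb C^r$ of $$\hat\zeta^{\mathrm{des}}_r(\mathbf s)(t)=C(\mathbf s)\int_{\mathcal C^r}\prod_{j=1}^r\Bigl(\frac1{\frac1te^{y_j}-1}+\frac{(\log t-y_j)\frac1te^{y_j}}{(\frac1te^{y_j}-1)^2}\Bigr)\prod_{k=1}^r x_k^{s_k-1}\,dx_k\qquad(\mathbf s\in(\mathbb C\setminus\mathbb Z)^r).$$ For functions $f$ on $(0,1)$ put $J[f](t)=\int_0^t f(z)\frac{dz}{z}$ and $D[f](t)=t\,f'(t)$, and write $J^{-1}=D$, so that $J^k$ is defined for all $k\in\mathbb Z$. Put $L^{\mathrm{des}}(0)(t)=\frac{t}{1-t}+\frac{t\log t}{(1-t)^2}$ and, for $k_1,\dots,k_r\in\mathbb Z$, $$L^{\mathrm{des}}(k_1,\dots,k_r)=J^{k_r}\Bigl[L^{\mathrm{des}}(0)\,J^{k_{r-1}}\bigl[L^{\mathrm{des}}(0)\cdots J^{k_1}[L^{\mathrm{des}}(0)]\cdots\bigr]\Bigr].$$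 Theorem. All these objects are well defined: the contour integrals converge absolutely (for $\zeta^{\mathrm{des}}_r$, for all real $c\neq1$ close enough to $1$), the limit for $c\to1$ and the entire continuations exist and do not depend on the choice of the sufficiently small $\epsilon$, and every $L^{\mathrm{des}}(k_1,\dots,k_r)$ is differentiable on $(0,1)$ and integrable against $dz/z$ on $(0,t)$ for every $t\in(0,1)$. For all $k_1,\dots,k_r\in\mathbb Z$ and all $t\in(0,1)$, $$\hat\zeta^{\mathrm{des}}_r(k_1,\dots,k_r)(t)=L^{\mathrm{des}}(k_1,\dots,k_r)(t).$$ Consequently, $$\lim_{t\to1-0}L^{\mathrm{des}}(k_1,\dots,k_r)(t)=\zeta^{\mathrm{des}}_r(k_1,\dots,k_r).$$ -/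

import Mathlib

open Filter Topology MeasureTheory

noncomputable section

/-! ### The Hankel contour

The contour comes from `+∞` along the upper side of the positive real axis to `ε`, runs once
counterclockwise around the circle of radius `ε`, and goes back to `+∞` along the lower side.
It is parametrized by `u ∈ ℝ`: incoming ray for `u < 0`, circle for `0 ≤ u ≤ 2π`, outgoing ray for
`2π < u`. -/

/-- The absolute value of the point of the contour with parameter `u`. -/
def hankelRadius (ε u : ℝ) : ℝ :=
  if u < 0 then ε - u else if u ≤ 2 * Real.pi then ε else ε + (u - 2 * Real.pi)

/-- The argument of the point of the contour with parameter `u`; it grows continuously from `0`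
to `2π`. -/
def hankelArg (u : ℝ) : ℝ :=
  if u < 0 then 0 else if u ≤ 2 * Real.pi then u else 2 * Real.pi

/-- The point of the contour with parameter `u`. -/
def hankelPath (ε u : ℝ) : ℂ :=
  (hankelRadius ε u : ℂ) * Complex.exp (Complex.I * (hankelArg u : ℂ))

/-- The velocity of the contour (its derivative in `u`, except at the two corners
`u = 0, 2π`, see `hasDerivAt_hankelPath`). -/
def hankelVel (ε u : ℝ) : ℂ :=
  if u < 0 then -1
  else if u ≤ 2 * Real.pi then Complex.I * (ε : ℂ) * Complex.exp (Complex.I * (u : ℂ))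
  else 1

theorem hasDerivAt_hankelPath (ε u : ℝ) (h₀ : u ≠ 0) (h₁ : u ≠ 2 * Real.pi) :
    HasDerivAt (hankelPath ε) (hankelVel ε u) u := by
  have hpi := Real.pi_pos
  rcases lt_or_gt_of_ne h₀ with h | h
  · have e : hankelPath ε =ᶠ[𝓝 u] fun v : ℝ => (ε : ℂ) - (v : ℂ) := by
      filter_upwards [Iio_mem_nhds h] with v hv
      have hv' : v < 0 := hv
      change hankelPath ε v = _
      simp [hankelPath, hankelRadius, hankelArg, hv']
    have d : HasDerivAt (fun v : ℝ => (ε : ℂ) - (v : ℂ)) (-1) u :=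
      (Complex.ofRealCLM.hasDerivAt (x := u)).const_sub (ε : ℂ)
    simpa [hankelVel, h] using d.congr_of_eventuallyEq e
  · rcases lt_or_gt_of_ne h₁ with h' | h'
    · have e : hankelPath ε =ᶠ[𝓝 u]
          fun v : ℝ => (ε : ℂ) * Complex.exp (Complex.I * (v : ℂ)) := by
        filter_upwards [Ioo_mem_nhds h h'] with v hv
        have hv0 : ¬ v < 0 := not_lt.2 hv.1.le
        have hv1 : v ≤ 2 * Real.pi := hv.2.le
        simp [hankelPath, hankelRadius, hankelArg, hv0, hv1]
      have d : HasDerivAt (fun v : ℝ => (ε : ℂ) * Complex.exp (Complex.I * (v : ℂ)))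
          ((ε : ℂ) * (Complex.exp (Complex.I * (u : ℂ)) * (Complex.I * 1))) u :=
        (((Complex.ofRealCLM.hasDerivAt (x := u)).const_mul Complex.I).cexp).const_mul (ε : ℂ)
      refine (d.congr_of_eventuallyEq e).congr_deriv ?_
      simp only [hankelVel, not_lt.2 h.le, h'.le, if_true, if_false]
      ring
    · have e : hankelPath ε =ᶠ[𝓝 u] fun v : ℝ => (ε : ℂ) + ((v : ℂ) - 2 * Real.pi) := by
        filter_upwards [Ioi_mem_nhds h'] with v hv
        have hv' : 2 * Real.pi < v := hv
        have hv0 : ¬ v < 0 := by linarith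
        have hx : Complex.exp (Complex.I * (2 * (Real.pi : ℂ))) = 1 := by
          rw [mul_comm]; exact Complex.exp_two_pi_mul_I
        simp [hankelPath, hankelRadius, hankelArg, hv0, not_le.2 hv', hx]
      have d : HasDerivAt (fun v : ℝ => (ε : ℂ) + ((v : ℂ) - 2 * Real.pi)) 1 u :=
        ((Complex.ofRealCLM.hasDerivAt (x := u)).sub_const (2 * Real.pi : ℂ)).const_add (ε : ℂ)
      refine (d.congr_of_eventuallyEq e).congr_deriv ?_
      simp [hankelVel, not_lt.2 h.le, not_le.2 h']

/-- The power `x ^ a` at the point `x` of the contour with parameter `u`, for the branch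
`log x = log |x| + i arg x` with `arg x` running from `0` to `2π` along the contour. -/
def hankelPow (ε : ℝ) (a : ℂ) (u : ℝ) : ℂ :=
  Complex.exp (a * ((Real.log (hankelRadius ε u) : ℂ) + Complex.I * (hankelArg u : ℂ)))

/-- The integrand of the `r`-fold contour integral of `Φ(x₁,…,x_r) ∏ x_k ^ (s_k - 1) dx_k`
in the parameters `(u₁,…,u_r) ∈ ℝ^r`. -/
def hankelIntegrand {r : ℕ} (Φ : (Fin r → ℂ) → ℂ) (ε : ℝ) (s : Fin r → ℂ) (u : Fin r → ℝ) : ℂ :=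
  Φ (fun k => hankelPath ε (u k)) * ∏ k, (hankelPow ε (s k - 1) (u k) * hankelVel ε (u k))

/-- The `r`-fold contour integral of `Φ(x₁,…,x_r) ∏ x_k ^ (s_k - 1) dx_k`. -/
def hankelIntegral {r : ℕ} (Φ : (Fin r → ℂ) → ℂ) (ε : ℝ) (s : Fin r → ℂ) : ℂ :=
  ∫ u : Fin r → ℝ, hankelIntegrand Φ ε s u

/-- `C(s) = ∏ 1 / ((e^{2πi s_k} - 1) Γ(s_k))`. -/
def hankelCoeff {r : ℕ} (s : Fin r → ℂ) : ℂ :=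
  ∏ k, 1 / ((Complex.exp (2 * Real.pi * Complex.I * s k) - 1) * Complex.Gamma (s k))

/-- All coordinates of `s` lie in `ℂ \ ℤ`. -/
def NonIntegral {r : ℕ} (s : Fin r → ℂ) : Prop :=
  ∀ k, ∀ n : ℤ, s k ≠ (n : ℂ)

/-! ### The desingularized multiple zeta function -/

/-- The generating function `∏_j (1 / (e^{y_j} - 1) - c / (e^{c y_j} - 1))`, where
`y_j = x_j + ⋯ + x_r`. -/
def desKernel (r : ℕ) (c : ℝ) (x : Fin r → ℂ) : ℂ :=
  ∏ j, (1 / (Complex.exp (∑ k ∈ Finset.Ici j, x k) - 1)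
    - (c : ℂ) / (Complex.exp ((c : ℂ) * ∑ k ∈ Finset.Ici j, x k) - 1))

/-- `Z` is the entire continuation to `ℂ^r` of the function defined on `(ℂ \ ℤ)^r` as the limit
for `c → 1`, `c ≠ 1`, of `(1 - c)^{-r} C(s) ∫ desKernel(x; c) ∏ x_k ^ (s_k - 1) dx_k` over the
Hankel contour of any sufficiently small radius. -/
def IsZetaDes (r : ℕ) (Z : (Fin r → ℂ) → ℂ) : Prop :=
  Differentiable ℂ Z ∧
  ∃ ε₀ > 0, ∀ ε ∈ Set.Ioo (0 : ℝ) ε₀, ∀ s : Fin r → ℂ, NonIntegral s →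
    (∀ᶠ c : ℝ in 𝓝[≠] 1, Integrable (hankelIntegrand (desKernel r c) ε s)) ∧
    Tendsto
      (fun c : ℝ => 1 / (1 - (c : ℂ)) ^ r * hankelCoeff s * hankelIntegral (desKernel r c) ε s)
      (𝓝[≠] 1) (𝓝 (Z s))

/-- The desingularized multiple zeta function `ζ_r^des` on `ℂ^r`. -/
def zetaDes (r : ℕ) : (Fin r → ℂ) → ℂ :=
  Classical.epsilon (IsZetaDes r)

/-! ### The one-parameter version -/

/-- The kernel
`∏_j (1 / (t⁻¹ e^{y_j} - 1) + (log t - y_j) t⁻¹ e^{y_j} / (t⁻¹ e^{y_j} - 1)²)`, where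
`y_j = x_j + ⋯ + x_r`. -/
def hatKernel (r : ℕ) (t : ℝ) (x : Fin r → ℂ) : ℂ :=
  ∏ j, (1 / (1 / (t : ℂ) * Complex.exp (∑ k ∈ Finset.Ici j, x k) - 1)
    + ((Real.log t : ℂ) - ∑ k ∈ Finset.Ici j, x k)
        * (1 / (t : ℂ) * Complex.exp (∑ k ∈ Finset.Ici j, x k))
        / (1 / (t : ℂ) * Complex.exp (∑ k ∈ Finset.Ici j, x k) - 1) ^ 2)

/-- For every `t ∈ (0,1)`, the function `F t` is the entire continuation to `ℂ^r` of the function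
`C(s) ∫ hatKernel(x; t) ∏ x_k ^ (s_k - 1) dx_k` on `(ℂ \ ℤ)^r`, with the integral over the Hankel
contour of any sufficiently small radius (how small does not depend on `t`). -/
def IsHatZetaDes (r : ℕ) (F : ℝ → (Fin r → ℂ) → ℂ) : Prop :=
  (∀ t ∈ Set.Ioo (0 : ℝ) 1, Differentiable ℂ (F t)) ∧
  ∃ ε₀ > 0, ∀ ε ∈ Set.Ioo (0 : ℝ) ε₀, ∀ t ∈ Set.Ioo (0 : ℝ) 1, ∀ s : Fin r → ℂ, NonIntegral s →
    Integrable (hankelIntegrand (hatKernel r t) ε s) ∧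
    F t s = hankelCoeff s * hankelIntegral (hatKernel r t) ε s

/-- The function `(t, s) ↦ \hat ζ_r^des(s)(t)` for `t ∈ (0,1)` and `s ∈ ℂ^r`. -/
def hatZetaDes (r : ℕ) : ℝ → (Fin r → ℂ) → ℂ :=
  Classical.epsilon (IsHatZetaDes r)

/-! ### The iterated integrals -/

/-- `J[f](t) = ∫_0^t f(z) dz / z`. -/
def opJ (f : ℝ → ℝ) (t : ℝ) : ℝ := ∫ z in (0 : ℝ)..t, f z / z

/-- `D[f](t) = t f'(t)`. -/
def opD (f : ℝ → ℝ) (t : ℝ) : ℝ := t * deriv f t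

/-- `J^k` for `k ∈ ℤ`, where `J^{-1} = D`. -/
def opJPow : ℤ → (ℝ → ℝ) → (ℝ → ℝ)
  | Int.ofNat n => opJ^[n]
  | Int.negSucc n => opD^[n + 1]

/-- `L^des(0)(t) = t / (1 - t) + t log t / (1 - t)²`. -/
def desLiZero (t : ℝ) : ℝ := t / (1 - t) + t * Real.log t / (1 - t) ^ 2

/-- `L^des(k₁,…,k_r) = J^{k_r}[L^des(0) J^{k_{r-1}}[L^des(0) ⋯ J^{k₁}[L^des(0)] ⋯ ]]`, as a
function on `(0,1)`. -/
def desLi : (r : ℕ) → (Fin r → ℤ) → ℝ → ℝ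
  | 0, _ => fun _ => 1
  | r + 1, k =>
      opJPow (k (Fin.last r)) (fun t => desLiZero t * desLi r (fun i => k i.castSucc) t)

end

/-! ### Parametric integrals of holomorphic functions -/

/-! Put `t = e^{-a}`. The kernel of `hatZetaDes` becomes `∏ G(a + y_j)` with `G(w) = 1/(e^w - 1) - w
e^w/(e^w - 1)^2`, the derivative of `w/(e^w - 1)`. Its singularity at `0` is removable, it is
holomorphic for `|Im w| < 2π`, and it decays exponentially as `Re w → +∞`. The same `G` is the limit
for `c → 1` of the difference quotient in the definition of `zetaDes`, so `zetaDes` is the value at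
`a = 0` of the same function of `a`, namely `desNested`. Since `a = 0` is an interior point of its
domain, the limit `t → 1` is plain continuity.

The last variable occurs in every `y_j`, hence it acts as a shift of the base point, and by Fubini
(`nestedIntegral_succ`) the `r`-fold integral is `T_{s_r}[G · T_{s_{r-1}}[G ⋯ T_{s_1}[G] ⋯ ]]`,
where `T_s f(w)` is `∫ f(w + x) x^{s-1} dx` over the contour, normalized by `1/((e^{2πis} - 1)
Γ(s))`. This has the shape of the recursion for `desLi`, so it remains to see that `T_m` is `J^m` at
integers. Cauchy's formula gives `T_0 f = f` (`pathTransform_hankel_zero`); integration by parts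
gives `(T_m f)' = -T_{m-1} f` (`hasDerivAt_pathTransform_int`); and `-d/da` is `t d/dt`. Decay for
`a → ∞` means vanishing at `t = 0`, which fixes the constants of integration (`RepresentedBy.opJ`,
`RepresentedBy.opJPow`).

For the continuation in `s`, the normalizing factor equals `Γ(1-s) e^{-πis}/(2πi)`, which is
holomorphic for `Re s < 1`, while for nonintegral `s` with `Re s > 0` the contour collapses to
`Γ(s)⁻¹ ∫_0^∞` (`pathTransform_hankel_eq_ray`). Gluing the two descriptions (`mixedPath`,
`exists_local_density`) makes `desNested` entire (`differentiable_desNested`). Its values at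
integers are forced by continuity from nonintegral points.

Throughout, functions live on half strips: each integration along a path near the positive axis
costs `ε` of the width, so starting from width `1` a strip of width `1 - rε > 0` is left after `r`
integrations. -/

theorem integrable_exp_neg_mul_abs {b : ℝ} (hb : 0 < b) :
    Integrable fun u : ℝ => Real.exp (-b * |u|) := by
  have h := (exp_neg_integrableOn_Ioi 0 hb)
  rw [← integrableOn_univ, ← Set.Iic_union_Ioi (a := (0 : ℝ))]
  refine IntegrableOn.union ?_ ?_
  · refine (integrableOn_exp_mul_Iic hb 0).congr_fun (fun x hx => ?_) measurableSet_Iic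
    have hx' : x ≤ 0 := hx
    simp [abs_of_nonpos hx']
  · refine h.congr_fun (fun x hx => ?_) measurableSet_Ioi
    have hx' : 0 < x := hx
    simp [abs_of_pos hx']

/-- Cauchy's estimate for the Fréchet derivative. -/
theorem norm_fderiv_le_div_of_norm_le {E : Type*} [NormedAddCommGroup E] [NormedSpace ℂ E]
    {f : E → ℂ} {x : E} {R C : ℝ} (hR : 0 < R)
    (hf : DifferentiableOn ℂ f (Metric.ball x R)) (hC : ∀ y ∈ Metric.ball x R, ‖f y‖ ≤ C) :
    ‖fderiv ℂ f x‖ ≤ C / R := by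
  have hC0 : 0 ≤ C := (norm_nonneg _).trans (hC x (Metric.mem_ball_self hR))
  refine ContinuousLinearMap.opNorm_le_bound _ (by positivity) fun h => ?_
  rcases eq_or_ne h 0 with rfl | hh
  · simp
  have hn : 0 < ‖h‖ := norm_pos_iff.2 hh
  have hmem : ∀ z : ℂ, ‖z‖ < R / ‖h‖ → x + z • h ∈ Metric.ball x R := fun z hz => by
    rw [mem_ball_iff_norm, add_sub_cancel_left, norm_smul]
    exact (lt_div_iff₀ hn).1 hz
  have hline : ∀ z : ℂ, ‖z‖ < R / ‖h‖ →
      HasDerivAt (fun z : ℂ => f (x + z • h)) (fderiv ℂ f (x + z • h) h) z := fun z hz => by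
    have h1 : HasFDerivAt f (fderiv ℂ f (x + z • h)) (x + z • h) :=
      ((hf _ (hmem z hz)).differentiableAt (Metric.isOpen_ball.mem_nhds (hmem z hz))).hasFDerivAt
    have h2 : HasDerivAt (fun z : ℂ => x + z • h) h z := by
      simpa using ((hasDerivAt_id z).smul_const h).const_add x
    exact h1.comp_hasDerivAt z h2
  -- The one-variable Cauchy estimate needs a closed disc inside the open ball, so it is applied
  -- with radius `ρ < R / ‖h‖`, and `ρ` then tends to `R / ‖h‖`.
  have key : ∀ ρ ∈ Set.Ioo 0 (R / ‖h‖), ‖fderiv ℂ f x h‖ ≤ C / ρ := fun ρ hρ => by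
    have hd : deriv (fun z : ℂ => f (x + z • h)) 0 = fderiv ℂ f x h := by
      simpa using (hline 0 (by simpa using hρ.1.trans hρ.2)).deriv
    rw [← hd]
    refine Complex.norm_deriv_le_of_forall_mem_sphere_norm_le hρ.1 ?_ fun z hz => ?_
    · refine DifferentiableOn.diffContOnCl fun z hz => ?_
      rw [closure_ball _ hρ.1.ne'] at hz
      exact (hline z ((by simpa using hz : ‖z‖ ≤ ρ).trans_lt
        hρ.2)).differentiableAt.differentiableWithinAt
    · exact hC _ (hmem z ((by simpa using hz : ‖z‖ = ρ).trans_lt hρ.2))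
  have hlim : Tendsto (fun ρ : ℝ => C / ρ) (𝓝[<] (R / ‖h‖)) (𝓝 (C / (R / ‖h‖))) :=
    (tendsto_const_nhds.div tendsto_id (by positivity)).mono_left nhdsWithin_le_nhds
  have := ge_of_tendsto hlim (by
    filter_upwards [Ioo_mem_nhdsLT (show (0 : ℝ) < R / ‖h‖ by positivity)] with ρ hρ
    exact key ρ hρ)
  calc _ ≤ _ := this
    _ = _ := by field_simp

/-- An integral depending holomorphically on finitely many parameters, with a locally uniform
integrable bound, is holomorphic in the parameters. -/
theorem differentiableAt_integral_of_norm_le {ι α : Type*} [Fintype ι] [MeasurableSpace α]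
    {μ : Measure α} {F : (ι → ℂ) → α → ℂ} {s₀ : ι → ℂ} {ρ : ℝ} (hρ : 0 < ρ) {bound : α → ℝ}
    (hmeas : ∀ s ∈ Metric.ball s₀ ρ, AEStronglyMeasurable (F s) μ)
    (hle : ∀ s ∈ Metric.ball s₀ ρ, ∀ v, ‖F s v‖ ≤ bound v) (hint : Integrable bound μ)
    (hdiff : ∀ v, DifferentiableOn ℂ (fun s => F s v) (Metric.ball s₀ ρ)) :
    DifferentiableAt ℂ (fun s => ∫ v, F s v ∂μ) s₀ := by
  classical
  have hs₀ : s₀ ∈ Metric.ball s₀ ρ := Metric.mem_ball_self hρ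
  have hat : ∀ v, ∀ s ∈ Metric.ball s₀ ρ,
      HasFDerivAt (fun s => F s v) (fderiv ℂ (fun s => F s v) s) s := fun v s hs =>
    ((hdiff v s hs).differentiableAt (Metric.isOpen_ball.mem_nhds hs)).hasFDerivAt
  -- Directional derivatives are limits of measurable difference quotients (the shift by `N` keeps
  -- the points in the ball), and in finite dimension the derivative is assembled from those along
  -- the basis vectors.
  have hF' : AEStronglyMeasurable (fun v => fderiv ℂ (fun s => F s v) s₀) μ := by
    have happ : ∀ e : ι → ℂ, AEStronglyMeasurable (fun v => fderiv ℂ (fun s => F s v) s₀ e) μ := by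
      intro e
      have ht : Tendsto (fun n : ℕ => ((n : ℂ) + 1)⁻¹) atTop (𝓝 0) := by
        simpa using (tendsto_one_div_add_atTop_nhds_zero_nat (𝕜 := ℂ))
      have hs : Tendsto (fun n : ℕ => s₀ + ((n : ℂ) + 1)⁻¹ • e) atTop (𝓝 s₀) := by
        simpa using (ht.smul_const e).const_add s₀
      obtain ⟨N, hN⟩ := eventually_atTop.1 (hs.eventually (Metric.ball_mem_nhds s₀ hρ))
      have hm : ∀ n : ℕ, AEStronglyMeasurable (fun v => ((n + N : ℕ) + 1 : ℂ) •
          (F (s₀ + (((n + N : ℕ) : ℂ) + 1)⁻¹ • e) v - F s₀ v)) μ := fun n =>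
        ((hmeas _ (hN (n + N) (Nat.le_add_left _ _))).sub (hmeas _ hs₀)).const_smul
          (((n + N : ℕ) : ℂ) + 1)
      refine aestronglyMeasurable_of_tendsto_ae atTop hm (ae_of_all _ fun v => ?_)
      refine (hat v s₀ hs₀).lim e (c := fun n : ℕ => ((n + N : ℕ) : ℂ) + 1) ?_
      have hn : (fun n : ℕ => ‖(((n + N : ℕ) : ℂ) + 1)‖) = fun n : ℕ => ((n + N : ℕ) : ℝ) + 1 := by
        ext n
        rw [← Nat.cast_add_one, Complex.norm_natCast]; simp
      rw [hn]
      exact tendsto_atTop_add_const_right _ _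
        (tendsto_natCast_atTop_atTop.comp (tendsto_add_atTop_nat N))
    have hrep : (fun v => fderiv ℂ (fun s => F s v) s₀) = fun v => ∑ i,
        fderiv ℂ (fun s => F s v) s₀ (Pi.single i 1) •
          ContinuousLinearMap.proj (R := ℂ) (φ := fun _ : ι => ℂ) i := by
      ext v x
      conv_lhs => rw [pi_eq_sum_univ' x, map_sum]
      simp [mul_comm]
    rw [hrep]
    exact Finset.aestronglyMeasurable_fun_sum _ fun i _ => (happ _).smul_const _
  refine (hasFDerivAt_integral_of_dominated_of_fderiv_le (F := F)
    (F' := fun s v => fderiv ℂ (fun s => F s v) s) (bound := fun v => bound v / (ρ / 2))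
    (Metric.ball_mem_nhds s₀ (half_pos hρ)) ?_ ?_ hF' ?_ (hint.div_const _) ?_).differentiableAt
  · filter_upwards [Metric.ball_mem_nhds s₀ hρ] with s hs using hmeas s hs
  · exact hint.mono' (hmeas _ hs₀) (ae_of_all _ (hle _ hs₀))
  · refine ae_of_all _ fun v s hs => ?_
    have hsub : Metric.ball s (ρ / 2) ⊆ Metric.ball s₀ ρ :=
      Metric.ball_subset_ball' (by linarith [Metric.mem_ball.1 hs])
    exact norm_fderiv_le_div_of_norm_le (half_pos hρ) ((hdiff v).mono hsub)
      fun y hy => hle y (hsub hy) v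
  · exact ae_of_all _ fun v s hs => hat v s (Metric.ball_subset_ball (by linarith) hs)

/-! ### Nested integrals along several paths -/

/-- The half strip `{Re w > -δ, |Im w| < δ}`. -/
def halfStrip (δ : ℝ) : Set ℂ := {w | -δ < w.re ∧ |w.im| < δ}

theorem isOpen_halfStrip (δ : ℝ) : IsOpen (halfStrip δ) :=
  (isOpen_lt continuous_const Complex.continuous_re).inter
    (isOpen_lt Complex.continuous_im.abs continuous_const)

theorem halfStrip_mono {δ δ' : ℝ} (h : δ ≤ δ') : halfStrip δ ⊆ halfStrip δ' := fun _ hw =>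
  ⟨by linarith [hw.1], hw.2.trans_le h⟩

theorem add_mem_halfStrip {δ ε : ℝ} {w x : ℂ} (hw : w ∈ halfStrip δ) (h₁ : -ε ≤ x.re)
    (h₂ : |x.im| ≤ ε) : w + x ∈ halfStrip (δ + ε) := by
  refine ⟨?_, ?_⟩
  · rw [Complex.add_re]; linarith [hw.1]
  · rw [Complex.add_im]; linarith [hw.2, abs_add_le w.im x.im]

theorem ofReal_mem_halfStrip {δ a : ℝ} (hδ : 0 < δ) (ha : 0 ≤ a) : (a : ℂ) ∈ halfStrip δ :=
  ⟨by simpa using by linarith, by simpa using hδ⟩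

/-- A path with values in `{Re x ≥ -ε, |Im x| ≤ ε}`. -/
structure IsNearRay (ε : ℝ) (p : ℝ → ℂ) : Prop where
  continuous : Continuous p
  re_ge : ∀ u, -ε ≤ (p u).re
  im_le : ∀ u, |(p u).im| ≤ ε

theorem IsNearRay.mono {ε ε' : ℝ} {p : ℝ → ℂ} (h : IsNearRay ε p) (hε : ε ≤ ε') :
    IsNearRay ε' p :=
  ⟨h.continuous, fun u => by linarith [h.re_ge u], fun u => (h.im_le u).trans hε⟩

theorem IsNearRay.add_mem {ε δ : ℝ} {p : ℝ → ℂ} (h : IsNearRay ε p) {w : ℂ}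
    (hw : w ∈ halfStrip (δ - ε)) (u : ℝ) : w + p u ∈ halfStrip δ := by
  simpa using add_mem_halfStrip hw (h.re_ge u) (h.im_le u)

/-- `κ` is a density whose product with `exp (-Re p / 4)` decays exponentially. -/
def IsDensity (p κ : ℝ → ℂ) : Prop :=
  Measurable κ ∧ ∃ C b : ℝ, 0 < b ∧
    ∀ u, ‖κ u‖ * Real.exp (-(p u).re / 4) ≤ C * Real.exp (-b * |u|)

/-- The integrand `∏_j G(a + p_j(u_j) + ⋯ + p_r(u_r)) ∏_k κ_k(u_k)`. -/
noncomputable def nestedIntegrand (G : ℂ → ℂ) {r : ℕ} (p κ : Fin r → ℝ → ℂ) (a : ℂ)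
    (u : Fin r → ℝ) : ℂ :=
  (∏ j, G (a + ∑ k ∈ Finset.Ici j, p k (u k))) * ∏ k, κ k (u k)

/-- The integral of `nestedIntegrand` over `ℝ^r`. -/
noncomputable def nestedIntegral (G : ℂ → ℂ) {r : ℕ} (p κ : Fin r → ℝ → ℂ) (a : ℂ) : ℂ :=
  ∫ u, nestedIntegrand G p κ a u

theorem sum_Ici_castSucc {r : ℕ} (x : Fin (r + 1) → ℂ) (j : Fin r) :
    ∑ k ∈ Finset.Ici j.castSucc, x k = x (Fin.last r) + ∑ k ∈ Finset.Ici j, x k.castSucc := by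
  have h1 : Finset.Ici j.castSucc = Finset.univ.filter fun k => j.castSucc ≤ k := by ext; simp
  have h2 : Finset.Ici j = Finset.univ.filter fun k => j ≤ k := by ext; simp
  rw [h1, h2, Finset.sum_filter, Finset.sum_filter, Fin.sum_univ_castSucc]
  simp [Fin.le_last, add_comm]

theorem sum_Ici_last {r : ℕ} (x : Fin (r + 1) → ℂ) :
    ∑ k ∈ Finset.Ici (Fin.last r), x k = x (Fin.last r) := by
  have : Finset.Ici (Fin.last r) = {Fin.last r} := by
    ext k; simp [Fin.last_le_iff]
  rw [this, Finset.sum_singleton]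

theorem prod_nested_succ (G : ℂ → ℂ) {r : ℕ} (x : Fin (r + 1) → ℂ) (a : ℂ) :
    ∏ j, G (a + ∑ k ∈ Finset.Ici j, x k) =
      G (a + x (Fin.last r)) *
        ∏ j : Fin r, G (a + x (Fin.last r) + ∑ k ∈ Finset.Ici j, x k.castSucc) := by
  rw [Fin.prod_univ_castSucc, sum_Ici_last, mul_comm]
  simp only [sum_Ici_castSucc, add_assoc]

/-- Each variable takes its decay from a single factor: in `G (a + x_last)` only the real part of
`x_last` is used, since the base point has real part `> -1` and costs at most `e^{1/4}`. The
remaining factors have `a + x_last` as base point, again with real part `> -1`, so the induction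
closes. -/
theorem norm_prod_nested_le {G : ℂ → ℂ} {M ε : ℝ} (hε : 0 ≤ ε)
    (hG : ∀ w ∈ halfStrip 1, ‖G w‖ ≤ M * Real.exp (-w.re / 4)) {r : ℕ} {x : Fin r → ℂ}
    (hre : ∀ k, -ε ≤ (x k).re) (him : ∀ k, |(x k).im| ≤ ε) {a : ℂ}
    (ha : a ∈ halfStrip (1 - r * ε)) :
    ‖∏ j, G (a + ∑ k ∈ Finset.Ici j, x k)‖ ≤
      (M * Real.exp (1 / 4)) ^ r * ∏ k, Real.exp (-(x k).re / 4) := by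
  have hM : 0 ≤ M := by
    have := (norm_nonneg _).trans (hG 0 (by simp [halfStrip]))
    simpa using this
  induction r generalizing a with
  | zero => simp
  | succ r ih =>
    have hmem : a + x (Fin.last r) ∈ halfStrip (1 - r * ε) := by
      have := add_mem_halfStrip ha (hre (Fin.last r)) (him (Fin.last r))
      refine halfStrip_mono (le_of_eq ?_) this
      push_cast; ring
    have hmem1 : a + x (Fin.last r) ∈ halfStrip 1 :=
      halfStrip_mono (by nlinarith [mul_nonneg (Nat.cast_nonneg (α := ℝ) r) hε]) hmem
    have ha1 : -1 < a.re := by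
      have := ha.1
      have h2 := mul_nonneg (Nat.cast_nonneg (α := ℝ) (r + 1)) hε
      linarith
    rw [prod_nested_succ, norm_mul, Fin.prod_univ_castSucc, pow_succ]
    have h1 : ‖G (a + x (Fin.last r))‖ ≤
        M * Real.exp (1 / 4) * Real.exp (-(x (Fin.last r)).re / 4) := by
      refine (hG _ hmem1).trans ?_
      rw [mul_assoc, ← Real.exp_add]
      refine mul_le_mul_of_nonneg_left (Real.exp_le_exp.2 ?_) hM
      rw [Complex.add_re]; linarith
    calc _ ≤ (M * Real.exp (1 / 4) * Real.exp (-(x (Fin.last r)).re / 4)) *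
          ((M * Real.exp (1 / 4)) ^ r * ∏ k : Fin r, Real.exp (-(x k.castSucc).re / 4)) :=
        mul_le_mul h1 (ih (fun k => hre _) (fun k => him _) hmem) (norm_nonneg _) (by positivity)
      _ = _ := by ring

theorem norm_nestedIntegrand_le {G : ℂ → ℂ} {M ε : ℝ} (hε : 0 ≤ ε)
    (hG : ∀ w ∈ halfStrip 1, ‖G w‖ ≤ M * Real.exp (-w.re / 4)) {r : ℕ} {p κ : Fin r → ℝ → ℂ}
    (hp : ∀ k, IsNearRay ε (p k)) {C b : Fin r → ℝ}
    (hκ : ∀ k u, ‖κ k u‖ * Real.exp (-(p k u).re / 4) ≤ C k * Real.exp (-b k * |u|)) {a : ℂ}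
    (ha : a ∈ halfStrip (1 - r * ε)) (u : Fin r → ℝ) :
    ‖nestedIntegrand G p κ a u‖ ≤
      (M * Real.exp (1 / 4)) ^ r * ∏ k, (C k * Real.exp (-b k * |u k|)) := by
  have hM : 0 ≤ M := by
    have := (norm_nonneg _).trans (hG 0 (by simp [halfStrip]))
    simpa using this
  rw [nestedIntegrand, norm_mul, norm_prod (f := fun k => κ k (u k))]
  calc _ ≤ ((M * Real.exp (1 / 4)) ^ r * ∏ k, Real.exp (-(p k (u k)).re / 4)) *
        ∏ k, ‖κ k (u k)‖ := by
        refine mul_le_mul_of_nonneg_right (norm_prod_nested_le hε hG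
          (fun k => (hp k).re_ge _) (fun k => (hp k).im_le _) ha)
          (Finset.prod_nonneg fun _ _ => norm_nonneg _)
    _ = (M * Real.exp (1 / 4)) ^ r * ∏ k, (‖κ k (u k)‖ * Real.exp (-(p k (u k)).re / 4)) := by
        rw [mul_assoc, ← Finset.prod_mul_distrib]
        simp only [mul_comm]
    _ ≤ _ := by
        refine mul_le_mul_of_nonneg_left ?_ (by positivity)
        exact Finset.prod_le_prod (fun _ _ => by positivity) fun k _ => hκ k _

theorem integrable_prod_exp_neg_mul_abs {r : ℕ} (C : Fin r → ℝ) {b : Fin r → ℝ}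
    (hb : ∀ k, 0 < b k) (K : ℝ) :
    Integrable fun u : Fin r → ℝ => K * ∏ k, (C k * Real.exp (-b k * |u k|)) :=
  (Integrable.fintype_prod (f := fun k x => C k * Real.exp (-b k * |x|)) fun k =>
    (integrable_exp_neg_mul_abs (hb k)).const_mul _).const_mul _

theorem measurable_nestedIntegrand {G : ℂ → ℂ} (hG : Measurable G) {r : ℕ} {p κ : Fin r → ℝ → ℂ}
    (hp : ∀ k, Measurable (p k)) (hκ : ∀ k, Measurable (κ k)) (a : ℂ) :
    Measurable (nestedIntegrand G p κ a) := by
  refine Measurable.mul ?_ ?_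
  · refine Finset.measurable_prod _ fun j _ => hG.comp (measurable_const.add ?_)
    exact Finset.measurable_sum _ fun k _ => (hp k).comp (measurable_pi_apply k)
  · exact Finset.measurable_prod _ fun k _ => (hκ k).comp (measurable_pi_apply k)

theorem integrable_nestedIntegrand {G : ℂ → ℂ} {M ε : ℝ} (hε : 0 ≤ ε) (hGm : Measurable G)
    (hG : ∀ w ∈ halfStrip 1, ‖G w‖ ≤ M * Real.exp (-w.re / 4)) {r : ℕ} {p κ : Fin r → ℝ → ℂ}
    (hp : ∀ k, IsNearRay ε (p k)) (hκ : ∀ k, IsDensity (p k) (κ k)) {a : ℂ}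
    (ha : a ∈ halfStrip (1 - r * ε)) : Integrable (nestedIntegrand G p κ a) := by
  choose C b hb hle using fun k => (hκ k).2
  refine (integrable_prod_exp_neg_mul_abs C hb _).mono'
    (measurable_nestedIntegrand hGm (fun k => (hp k).continuous.measurable)
      (fun k => (hκ k).1) a).aestronglyMeasurable
    (ae_of_all _ (norm_nestedIntegrand_le hε hG hp hle ha))

theorem nestedIntegral_zero (G : ℂ → ℂ) (p κ : Fin 0 → ℝ → ℂ) (a : ℂ) :
    nestedIntegral G p κ a = 1 := by
  simp [nestedIntegral, nestedIntegrand, volume_pi, measureReal_def]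

/-- Since the last variable enters every partial sum, fixing it turns the remaining factors into the
same integrand in `r` variables with base point shifted by `p_last(v)`. Fubini does the rest. -/
theorem nestedIntegral_succ {G : ℂ → ℂ} {M ε : ℝ} (hε : 0 ≤ ε) (hGm : Measurable G)
    (hG : ∀ w ∈ halfStrip 1, ‖G w‖ ≤ M * Real.exp (-w.re / 4)) {r : ℕ}
    {p κ : Fin (r + 1) → ℝ → ℂ} (hp : ∀ k, IsNearRay ε (p k))
    (hκ : ∀ k, IsDensity (p k) (κ k)) {a : ℂ} (ha : a ∈ halfStrip (1 - (r + 1 : ℕ) * ε)) :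
    nestedIntegral G p κ a = ∫ v, G (a + p (Fin.last r) v) *
      nestedIntegral G (fun k : Fin r => p k.castSucc) (fun k : Fin r => κ k.castSucc)
        (a + p (Fin.last r) v) * κ (Fin.last r) v := by
  have hint := integrable_nestedIntegrand hε hGm hG hp hκ ha
  have e := (volume_preserving_piFinSuccAbove (fun _ : Fin (r + 1) => ℝ) (Fin.last r)).symm
  rw [nestedIntegral, ← e.integral_comp (MeasurableEquiv.measurableEmbedding _)]
  rw [← e.integrable_comp_emb (MeasurableEquiv.measurableEmbedding _)] at hint
  rw [Measure.volume_eq_prod] at hint ⊢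
  refine (integral_prod _ hint).trans ?_
  refine integral_congr_ae (ae_of_all _ fun v => ?_)
  simp only [nestedIntegral]
  rw [← integral_const_mul, ← integral_mul_const]
  refine integral_congr_ae (ae_of_all _ fun y => ?_)
  have hlast : (MeasurableEquiv.piFinSuccAbove (fun _ : Fin (r + 1) => ℝ) (Fin.last r)).symm
      (v, y) (Fin.last r) = v := by
    simp [MeasurableEquiv.piFinSuccAbove_symm_apply, Fin.insertNthEquiv]
  have hcast : ∀ k : Fin r, (MeasurableEquiv.piFinSuccAbove (fun _ : Fin (r + 1) => ℝ)
      (Fin.last r)).symm (v, y) k.castSucc = y k := fun k => by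
    simp [MeasurableEquiv.piFinSuccAbove_symm_apply, Fin.insertNthEquiv, Fin.snoc_castSucc]
  simp only [nestedIntegrand, Function.comp_apply]
  rw [prod_nested_succ G (fun k => p k ((MeasurableEquiv.piFinSuccAbove
    (fun _ : Fin (r + 1) => ℝ) (Fin.last r)).symm (v, y) k)), Fin.prod_univ_castSucc]
  simp only [hlast, hcast]
  ring

/-! ### Integral transforms of holomorphic functions on half strips -/

/-- `f` is holomorphic on the half strip with `f(w) = O(exp (-Re w / 4))`. -/
def IsDecaying (δ : ℝ) (f : ℂ → ℂ) : Prop :=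
  DifferentiableOn ℂ f (halfStrip δ) ∧
    ∃ M : ℝ, ∀ w ∈ halfStrip δ, ‖f w‖ ≤ M * Real.exp (-w.re / 4)

/-- The transform `w ↦ ∫ f(w + p(u)) κ(u) du`. -/
noncomputable def pathTransform (p κ : ℝ → ℂ) (f : ℂ → ℂ) (w : ℂ) : ℂ := ∫ u, f (w + p u) * κ u

theorem IsDecaying.mono {δ δ' : ℝ} {f : ℂ → ℂ} (hf : IsDecaying δ f) (h : δ' ≤ δ) :
    IsDecaying δ' f :=
  ⟨hf.1.mono (halfStrip_mono h), hf.2.imp fun _ hM w hw => hM w (halfStrip_mono h hw)⟩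

theorem nonneg_of_forall_norm_le {δ M : ℝ} {f : ℂ → ℂ}
    (hM : ∀ w ∈ halfStrip δ, ‖f w‖ ≤ M * Real.exp (-w.re / 4)) {w : ℂ} (hw : w ∈ halfStrip δ) :
    0 ≤ M :=
  nonneg_of_mul_nonneg_left ((norm_nonneg _).trans (hM w hw)) (Real.exp_pos _)

theorem ball_subset_halfStrip {δ η : ℝ} {w : ℂ} (hw : w ∈ halfStrip (δ - η)) :
    Metric.ball w η ⊆ halfStrip δ := fun z hz => by
  have hz' : ‖z - w‖ ≤ η := (mem_ball_iff_norm.1 hz).le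
  have h1 := abs_le.1 ((Complex.abs_re_le_norm (z - w)).trans hz')
  have := add_mem_halfStrip (ε := η) (x := z - w) hw (by linarith [h1.1])
    ((Complex.abs_im_le_norm (z - w)).trans hz')
  simpa using this

theorem exists_pos_mem_halfStrip_sub {δ : ℝ} {w : ℂ} (hw : w ∈ halfStrip δ) :
    ∃ η > 0, w ∈ halfStrip (δ - η) := by
  refine ⟨min (δ + w.re) (δ - |w.im|) / 2, ?_, ?_, ?_⟩
  · have : 0 < min (δ + w.re) (δ - |w.im|) := lt_min (by linarith [hw.1]) (by linarith [hw.2])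
    linarith
  · linarith [min_le_left (δ + w.re) (δ - |w.im|), hw.1]
  · linarith [min_le_right (δ + w.re) (δ - |w.im|), hw.2]

/-- Cauchy's estimate on discs of radius `η` preserves the exponential decay; the price is `η` of
the strip. -/
theorem IsDecaying.deriv {δ η : ℝ} {f : ℂ → ℂ} (hf : IsDecaying δ f) (hη : 0 < η) :
    IsDecaying (δ - η) (deriv f) := by
  obtain ⟨hd, M, hM⟩ := hf
  refine ⟨(hd.deriv (isOpen_halfStrip δ)).mono (halfStrip_mono (by linarith)),
    M * Real.exp (η / 4) / η, fun w hw => ?_⟩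
  have hsub := ball_subset_halfStrip hw
  have hM0 := nonneg_of_forall_norm_le hM (hsub (Metric.mem_ball_self hη))
  have := norm_fderiv_le_div_of_norm_le (C := M * Real.exp (η / 4) * Real.exp (-w.re / 4)) hη
    (hd.mono hsub) fun z hz => by
      refine (hM z (hsub hz)).trans ?_
      rw [mul_assoc, ← Real.exp_add]
      refine mul_le_mul_of_nonneg_left (Real.exp_le_exp.2 ?_) hM0
      have h1 := abs_le.1 ((Complex.abs_re_le_norm (z - w)).trans (mem_ball_iff_norm.1 hz).le)
      rw [Complex.sub_re] at h1
      linarith [h1.1]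
  rw [← norm_deriv_eq_norm_fderiv] at this
  refine this.trans (le_of_eq (by ring))

section transform

variable {δ ε : ℝ} {f : ℂ → ℂ} {p κ : ℝ → ℂ}

theorem IsDecaying.aestronglyMeasurable_comp_mul (hf : IsDecaying δ f) (hp : IsNearRay ε p)
    (hκ : IsDensity p κ) {w : ℂ} (hw : w ∈ halfStrip (δ - ε)) :
    AEStronglyMeasurable (fun u => f (w + p u) * κ u) := by
  have hc : Continuous fun u => f (w + p u) :=
    hf.1.continuousOn.comp_continuous (continuous_const.add hp.continuous) fun u => hp.add_mem hw u
  exact (hc.measurable.mul hκ.1).aestronglyMeasurable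

theorem norm_comp_mul_le {M C b : ℝ} (hM : ∀ w ∈ halfStrip δ, ‖f w‖ ≤ M * Real.exp (-w.re / 4))
    (hp : IsNearRay ε p) {u : ℝ} (hκ : ‖κ u‖ * Real.exp (-(p u).re / 4) ≤ C * Real.exp (-b * |u|))
    {w : ℂ} (hw : w ∈ halfStrip (δ - ε)) :
    ‖f (w + p u) * κ u‖ ≤ M * Real.exp (-w.re / 4) * (C * Real.exp (-b * |u|)) := by
  have hM0 := nonneg_of_forall_norm_le hM (hp.add_mem hw u)
  rw [norm_mul]
  calc _ ≤ M * Real.exp (-(w + p u).re / 4) * ‖κ u‖ :=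
        mul_le_mul_of_nonneg_right (hM _ (hp.add_mem hw u)) (norm_nonneg _)
    _ = M * Real.exp (-w.re / 4) * (‖κ u‖ * Real.exp (-(p u).re / 4)) := by
        rw [Complex.add_re, neg_add, add_div, Real.exp_add]; ring
    _ ≤ _ := mul_le_mul_of_nonneg_left hκ (by positivity)

theorem IsDecaying.integrable_comp_mul (hf : IsDecaying δ f) (hp : IsNearRay ε p)
    (hκ : IsDensity p κ) {w : ℂ} (hw : w ∈ halfStrip (δ - ε)) :
    Integrable fun u => f (w + p u) * κ u := by
  obtain ⟨M, hM⟩ := hf.2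
  obtain ⟨C, b, hb, hC⟩ := hκ.2
  exact (((integrable_exp_neg_mul_abs hb).const_mul C).const_mul
    (M * Real.exp (-w.re / 4))).mono' (hf.aestronglyMeasurable_comp_mul hp hκ hw)
    (ae_of_all _ fun u => norm_comp_mul_le hM hp (hC u) hw)

theorem IsDecaying.hasDerivAt_pathTransform (hf : IsDecaying δ f) (hp : IsNearRay ε p)
    (hκ : IsDensity p κ) {w : ℂ} (hw : w ∈ halfStrip (δ - ε)) :
    HasDerivAt (pathTransform p κ f) (pathTransform p κ (_root_.deriv f) w) w := by
  -- The derivative of `f` is bounded only on smaller strips; room `η` is available because `w` is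
  -- an interior point.
  obtain ⟨η, hη, hwη⟩ := exists_pos_mem_halfStrip_sub hw
  have hf' := hf.deriv hη
  obtain ⟨M, hM⟩ := hf'.2
  obtain ⟨C, b, hb, hC⟩ := hκ.2
  have hopen := (isOpen_halfStrip (δ - η - ε)).mem_nhds (by convert hwη using 2; ring)
  have hsub : ∀ z ∈ halfStrip (δ - η - ε), z ∈ halfStrip (δ - ε) := fun z hz =>
    halfStrip_mono (by linarith) hz
  have hM0 := nonneg_of_forall_norm_le hM (hp.add_mem (mem_of_mem_nhds hopen) 0)
  have hC0 : 0 ≤ C := nonneg_of_mul_nonneg_left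
    ((mul_nonneg (norm_nonneg _) (Real.exp_pos _).le).trans (hC 0)) (Real.exp_pos _)
  refine (hasDerivAt_integral_of_dominated_loc_of_deriv_le
    (F := fun z u => f (z + p u) * κ u) (F' := fun z u => _root_.deriv f (z + p u) * κ u)
    (bound := fun u => M * Real.exp ((δ - η - ε) / 4) * (C * Real.exp (-b * |u|)))
    hopen ?_ (hf.integrable_comp_mul hp hκ hw)
    (hf'.aestronglyMeasurable_comp_mul hp hκ (mem_of_mem_nhds hopen)) ?_
    (((integrable_exp_neg_mul_abs hb).const_mul C).const_mul _) ?_).2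
  · filter_upwards [hopen] with z hz using hf.aestronglyMeasurable_comp_mul hp hκ (hsub z hz)
  · refine ae_of_all _ fun u z hz => (norm_comp_mul_le hM hp (hC u) hz).trans ?_
    have := hz.1
    gcongr
    linarith
  · refine ae_of_all _ fun u z hz => HasDerivAt.mul_const ?_ _
    have h1 : HasDerivAt f (_root_.deriv f (z + p u)) (z + p u) :=
      (hf.1.differentiableAt ((isOpen_halfStrip δ).mem_nhds
        (hp.add_mem (hsub z hz) u))).hasDerivAt
    exact h1.comp_add_const z (p u)

theorem IsDecaying.pathTransform (hf : IsDecaying δ f) (hp : IsNearRay ε p)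
    (hκ : IsDensity p κ) : IsDecaying (δ - ε) (pathTransform p κ f) := by
  refine ⟨fun w hw =>
    (hf.hasDerivAt_pathTransform hp hκ hw).differentiableAt.differentiableWithinAt, ?_⟩
  obtain ⟨M, hM⟩ := hf.2
  obtain ⟨C, b, hb, hC⟩ := hκ.2
  refine ⟨M * ∫ u, C * Real.exp (-b * |u|), fun w hw => ?_⟩
  calc _ ≤ ∫ u, M * Real.exp (-w.re / 4) * (C * Real.exp (-b * |u|)) :=
        norm_integral_le_of_norm_le
          (((integrable_exp_neg_mul_abs hb).const_mul C).const_mul _)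
          (ae_of_all _ fun u => norm_comp_mul_le hM hp (hC u) hw)
    _ = _ := by rw [integral_const_mul]; ring

end transform

/-! ### Nested integrals of a decaying function -/

section nested

variable {ε : ℝ} {G : ℂ → ℂ}

theorem IsDecaying.mul_of_bounded {δ δ' B : ℝ} {F : ℂ → ℂ} (hG : IsDecaying δ G) (h : δ' ≤ δ)
    (hF : DifferentiableOn ℂ F (halfStrip δ')) (hB : ∀ w ∈ halfStrip δ', ‖F w‖ ≤ B) :
    IsDecaying δ' fun w => G w * F w := by
  obtain ⟨M, hM⟩ := hG.2
  refine ⟨(hG.1.mono (halfStrip_mono h)).mul hF, M * B, fun w hw => ?_⟩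
  have h1 := hM w (halfStrip_mono h hw)
  rw [norm_mul]
  calc _ ≤ M * Real.exp (-w.re / 4) * B :=
        mul_le_mul h1 (hB w hw) (norm_nonneg _) ((norm_nonneg _).trans h1)
    _ = _ := by ring

theorem IsDecaying.exists_norm_le {δ : ℝ} {f : ℂ → ℂ} (hf : IsDecaying δ f) :
    ∃ B, ∀ w ∈ halfStrip δ, ‖f w‖ ≤ B := by
  obtain ⟨M, hM⟩ := hf.2
  refine ⟨M * Real.exp (δ / 4), fun w hw => (hM w hw).trans ?_⟩
  have := hw.1
  exact mul_le_mul_of_nonneg_left (Real.exp_le_exp.2 (by linarith))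
    (nonneg_of_forall_norm_le hM hw)

theorem nestedIntegral_succ_eq_pathTransform (hε : 0 ≤ ε) (hGm : Measurable G)
    (hG : IsDecaying 1 G) {r : ℕ}
    {p κ : Fin (r + 1) → ℝ → ℂ} (hp : ∀ k, IsNearRay ε (p k))
    (hκ : ∀ k, IsDensity (p k) (κ k)) {a : ℂ} (ha : a ∈ halfStrip (1 - (r + 1 : ℕ) * ε)) :
    nestedIntegral G p κ a = pathTransform (p (Fin.last r)) (κ (Fin.last r)) (fun w => G w *
      nestedIntegral G (fun k : Fin r => p k.castSucc) (fun k : Fin r => κ k.castSucc) w) a := by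
  obtain ⟨M, hM⟩ := hG.2
  exact nestedIntegral_succ hε hGm hM hp hκ ha

/-- The factor `G` is part of the statement because the nested integral alone need not decay: for `r
= 0` it is the constant `1`. The product is exactly what the next transform is applied to. -/
theorem IsDecaying.mul_nestedIntegral (hε : 0 ≤ ε) (hGm : Measurable G) (hG : IsDecaying 1 G)
    {r : ℕ} {p κ : Fin r → ℝ → ℂ} (hp : ∀ k, IsNearRay ε (p k))
    (hκ : ∀ k, IsDensity (p k) (κ k)) :
    IsDecaying (1 - r * ε) fun w => G w * nestedIntegral G p κ w := by
  have hle : 1 - r * ε ≤ 1 := by nlinarith [mul_nonneg (Nat.cast_nonneg (α := ℝ) r) hε]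
  induction r with
  | zero =>
    simp only [nestedIntegral_zero, mul_one]
    exact hG.mono hle
  | succ r ih =>
    have h1 := (ih (fun k => hp k.castSucc) (fun k => hκ k.castSucc)
      (by nlinarith [mul_nonneg (Nat.cast_nonneg (α := ℝ) r) hε])).pathTransform
      (hp (Fin.last r)) (hκ (Fin.last r))
    have e : (1 : ℝ) - r * ε - ε = 1 - (r + 1 : ℕ) * ε := by push_cast; ring
    rw [e] at h1
    have heq : Set.EqOn (nestedIntegral G p κ) _ (halfStrip (1 - (r + 1 : ℕ) * ε)) :=
      fun a ha => nestedIntegral_succ_eq_pathTransform hε hGm hG hp hκ ha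
    obtain ⟨B, hB⟩ := h1.exists_norm_le
    exact hG.mul_of_bounded hle (h1.1.congr heq) fun w hw => (heq hw) ▸ hB w hw

theorem IsDecaying.continuousAt_nestedIntegral (hε : 0 ≤ ε) (hGm : Measurable G)
    (hG : IsDecaying 1 G) {r : ℕ} {p κ : Fin r → ℝ → ℂ} (hp : ∀ k, IsNearRay ε (p k))
    (hκ : ∀ k, IsDensity (p k) (κ k)) {a : ℂ} (ha : a ∈ halfStrip (1 - r * ε)) :
    ContinuousAt (nestedIntegral G p κ) a := by
  cases r with
  | zero =>
    simp only [funext (nestedIntegral_zero G p κ)]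
    exact continuousAt_const
  | succ r =>
    have h1 := (hG.mul_nestedIntegral hε hGm (fun k => hp k.castSucc)
      (fun k => hκ k.castSucc)).pathTransform (hp (Fin.last r)) (hκ (Fin.last r))
    have e : (1 : ℝ) - r * ε - ε = 1 - (r + 1 : ℕ) * ε := by push_cast; ring
    rw [e] at h1
    have heq : Set.EqOn (nestedIntegral G p κ) _ (halfStrip (1 - (r + 1 : ℕ) * ε)) :=
      fun a ha => nestedIntegral_succ_eq_pathTransform hε hGm hG hp hκ ha
    exact (h1.1.congr heq).continuousOn.continuousAt ((isOpen_halfStrip _).mem_nhds ha)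

/-- Nested integrals only depend on the transforms given by the paths and densities. -/
theorem nestedIntegral_congr (hε : 0 ≤ ε) (hGm : Measurable G) (hG : IsDecaying 1 G) {r : ℕ}
    {p κ p' κ' : Fin r → ℝ → ℂ} (hp : ∀ k, IsNearRay ε (p k)) (hκ : ∀ k, IsDensity (p k) (κ k))
    (hp' : ∀ k, IsNearRay ε (p' k)) (hκ' : ∀ k, IsDensity (p' k) (κ' k))
    (heq : ∀ k, ∀ δ f, IsDecaying δ f → ∀ w ∈ halfStrip (δ - ε),
      pathTransform (p k) (κ k) f w = pathTransform (p' k) (κ' k) f w) {a : ℂ}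
    (ha : a ∈ halfStrip (1 - r * ε)) : nestedIntegral G p κ a = nestedIntegral G p' κ' a := by
  induction r generalizing a with
  | zero => simp [nestedIntegral_zero]
  | succ r ih =>
    have e : (1 : ℝ) - r * ε - ε = 1 - (r + 1 : ℕ) * ε := by push_cast; ring
    rw [nestedIntegral_succ_eq_pathTransform hε hGm hG hp hκ ha,
      nestedIntegral_succ_eq_pathTransform hε hGm hG hp' hκ' ha,
      ← heq _ _ _ (hG.mul_nestedIntegral hε hGm (fun k => hp' k.castSucc)
        (fun k => hκ' k.castSucc)) a (e ▸ ha)]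
    refine integral_congr_ae (ae_of_all _ fun u => ?_)
    simp only
    rw [ih (fun k => hp _) (fun k => hκ _) (fun k => hp' _) (fun k => hκ' _) (fun k => heq _)
      ((hp _).add_mem (e ▸ ha) u)]

/-- Changing `G` on a set that the paths avoid almost everywhere does not change the integral. -/
theorem nestedIntegral_congr_left {G' : ℂ → ℂ} {M : ℝ} (hε : 0 ≤ ε) (hGm : Measurable G)
    (hG : ∀ w ∈ halfStrip 1, ‖G w‖ ≤ M * Real.exp (-w.re / 4)) (hGm' : Measurable G')
    (hG' : ∀ w ∈ halfStrip 1, ‖G' w‖ ≤ M * Real.exp (-w.re / 4)) {r : ℕ} {p κ : Fin r → ℝ → ℂ}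
    (hp : ∀ k, IsNearRay ε (p k)) (hκ : ∀ k, IsDensity (p k) (κ k))
    (hne : ∀ k z, ∀ᵐ u, p k u ≠ z) (heq : ∀ w ∈ halfStrip 1, w ≠ 0 → G w = G' w) {a : ℂ}
    (ha : a ∈ halfStrip (1 - r * ε)) : nestedIntegral G p κ a = nestedIntegral G' p κ a := by
  induction r generalizing a with
  | zero => simp [nestedIntegral_zero]
  | succ r ih =>
    have e : (1 : ℝ) - r * ε - ε = 1 - (r + 1 : ℕ) * ε := by push_cast; ring
    rw [nestedIntegral_succ hε hGm hG hp hκ ha, nestedIntegral_succ hε hGm' hG' hp hκ ha]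
    refine integral_congr_ae ?_
    -- The shifted base point `a + p_last(u)` is the exceptional point `0` only for `p_last(u) =
    -- -a`, a null set of `u`.
    filter_upwards [hne (Fin.last r) (-a)] with u hu
    have hmem := (hp (Fin.last r)).add_mem (e ▸ ha) u
    rw [ih (fun k => hp _) (fun k => hκ _) (fun k => hne _) hmem,
      heq _ (halfStrip_mono (by nlinarith [mul_nonneg (Nat.cast_nonneg (α := ℝ) r) hε]) hmem)]
    exact fun h => hu (eq_neg_of_add_eq_zero_right h)

end nested

/-! ### The Hankel contour and the positive ray as paths with densities -/

theorem hankelRadius_eq (ε u : ℝ) :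
    hankelRadius ε u = ε + max 0 (-u) + max 0 (u - 2 * Real.pi) := by
  have := Real.pi_pos
  unfold hankelRadius
  split_ifs with h1 h2
  · rw [max_eq_right (by linarith), max_eq_left (by linarith)]; ring
  · rw [max_eq_left (by linarith), max_eq_left (by linarith)]; ring
  · rw [max_eq_left (by linarith), max_eq_right (by linarith)]; ring

theorem hankelArg_eq (u : ℝ) : hankelArg u = min (max u 0) (2 * Real.pi) := by
  have := Real.pi_pos
  unfold hankelArg
  split_ifs with h1 h2
  · rw [max_eq_right (by linarith), min_eq_left (by linarith)]
  · rw [max_eq_left (by linarith), min_eq_left (by linarith)]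
  · rw [max_eq_left (by linarith), min_eq_right (by linarith)]

theorem continuous_hankelRadius (ε : ℝ) : Continuous (hankelRadius ε) := by
  simp only [funext (hankelRadius_eq ε)]
  fun_prop

theorem continuous_hankelArg : Continuous hankelArg := by
  simp only [funext hankelArg_eq]
  fun_prop

theorem hankelRadius_ge (ε u : ℝ) : ε ≤ hankelRadius ε u := by
  rw [hankelRadius_eq]
  linarith [le_max_left 0 (-u), le_max_left 0 (u - 2 * Real.pi)]

theorem abs_sub_le_hankelRadius {ε : ℝ} (hε : 0 ≤ ε) (u : ℝ) :
    |u| - 2 * Real.pi ≤ hankelRadius ε u := by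
  rw [hankelRadius_eq]
  rcases abs_cases u with h | h <;> rw [h.1] <;>
  linarith [le_max_left 0 (-u), le_max_left 0 (u - 2 * Real.pi), le_max_right 0 (-u),
    le_max_right 0 (u - 2 * Real.pi), Real.pi_pos]

theorem hankelArg_mem (u : ℝ) : 0 ≤ hankelArg u ∧ hankelArg u ≤ 2 * Real.pi := by
  rw [hankelArg_eq]
  exact ⟨le_min (le_max_right _ _) (by positivity), min_le_right _ _⟩

theorem continuous_hankelPath (ε : ℝ) : Continuous (hankelPath ε) := by
  have h1 := continuous_hankelRadius ε
  have h2 := continuous_hankelArg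
  unfold hankelPath
  fun_prop

theorem hankelPath_of_neg {ε u : ℝ} (hu : u < 0) : hankelPath ε u = ((ε - u : ℝ) : ℂ) := by
  simp [hankelPath, hankelRadius, hankelArg, hu]

theorem hankelPath_of_mem {ε u : ℝ} (h0 : 0 ≤ u) (h1 : u ≤ 2 * Real.pi) :
    hankelPath ε u = (ε : ℂ) * Complex.exp (Complex.I * (u : ℂ)) := by
  simp [hankelPath, hankelRadius, hankelArg, not_lt.2 h0, h1]

theorem exp_I_mul_two_pi : Complex.exp (Complex.I * (2 * (Real.pi : ℂ))) = 1 := by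
  rw [mul_comm]; exact Complex.exp_two_pi_mul_I

theorem hankelPath_of_gt {ε u : ℝ} (hu : 2 * Real.pi < u) :
    hankelPath ε u = ((ε + (u - 2 * Real.pi) : ℝ) : ℂ) := by
  have h0 : ¬ u < 0 := by linarith [Real.pi_pos]
  simp [hankelPath, hankelRadius, hankelArg, h0, not_le.2 hu, exp_I_mul_two_pi]

theorem hankelPath_re_ge {ε : ℝ} (hε : 0 < ε) (u : ℝ) :
    hankelRadius ε u - 2 * ε ≤ (hankelPath ε u).re := by
  rcases lt_or_ge u 0 with h | h
  · rw [hankelPath_of_neg h, Complex.ofReal_re, hankelRadius, if_pos h]; linarith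
  · rcases le_or_gt u (2 * Real.pi) with h' | h'
    · rw [hankelPath_of_mem h h', hankelRadius, if_neg (not_lt.2 h), if_pos h', Complex.re_ofReal_mul,
        mul_comm Complex.I, Complex.exp_ofReal_mul_I_re]
      nlinarith [Real.neg_one_le_cos u]
    · rw [hankelPath_of_gt h', Complex.ofReal_re, hankelRadius, if_neg (not_lt.2 h),
        if_neg (not_le.2 h')]; linarith

theorem isNearRay_hankelPath {ε : ℝ} (hε : 0 < ε) : IsNearRay ε (hankelPath ε) where
  continuous := continuous_hankelPath ε
  re_ge u := by linarith [hankelPath_re_ge hε u, hankelRadius_ge ε u]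
  im_le u := by
    rcases lt_or_ge u 0 with h | h
    · rw [hankelPath_of_neg h, Complex.ofReal_im, abs_zero]; exact hε.le
    · rcases le_or_gt u (2 * Real.pi) with h' | h'
      · rw [hankelPath_of_mem h h', Complex.im_ofReal_mul, mul_comm Complex.I,
          Complex.exp_ofReal_mul_I_im, abs_mul, abs_of_pos hε]
        nlinarith [Real.abs_sin_le_one u]
      · rw [hankelPath_of_gt h', Complex.ofReal_im, abs_zero]; exact hε.le

theorem norm_hankelVel_le {ε : ℝ} (hε : 0 < ε) (u : ℝ) : ‖hankelVel ε u‖ ≤ 1 + ε := by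
  unfold hankelVel
  split_ifs
  · simpa using hε.le
  · rw [norm_mul, norm_mul, mul_comm Complex.I, Complex.norm_exp_ofReal_mul_I]
    simp [abs_of_pos hε]
  · simpa using hε.le

theorem measurable_hankelVel (ε : ℝ) : Measurable (hankelVel ε) := by
  unfold hankelVel
  refine Measurable.ite measurableSet_Iio measurable_const
    (Measurable.ite measurableSet_Iic ?_ measurable_const)
  fun_prop

theorem measurable_hankelPow (ε : ℝ) (z : ℂ) : Measurable (hankelPow ε z) := by
  have h1 := (continuous_hankelRadius ε).measurable
  have h2 := continuous_hankelArg.measurable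
  unfold hankelPow
  fun_prop

/-- The power is at most `e^{2πB} e^{B |log R|}` with `R` the modulus, and `log R` is dominated by a
small multiple of `R`, so half of the decay `e^{-R/4}` survives. The constant is uniform in the
exponent, as holomorphy in `s` requires. -/
theorem exists_norm_hankelPow_mul_le {ε : ℝ} (hε : 0 < ε) {B : ℝ} (hB : 0 ≤ B) :
    ∃ C : ℝ, ∀ z : ℂ, ‖z‖ ≤ B → ∀ u, ‖hankelPow ε z u * hankelVel ε u‖ *
      Real.exp (-(hankelPath ε u).re / 4) ≤ C * Real.exp (-(1 / 8) * |u|) := by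
  -- `log R ≤ R / K + log K` gives `B log R ≤ R / 8 + const`, which leaves `e^{-R/8}` out of
  -- `e^{-R/4}`. The term `π / 4` in the constant is the loss in `R ≥ |u| - 2π`, and `ε / 2` the
  -- loss in `Re x ≥ R - 2ε`.
  set K : ℝ := 8 * (B + 1) with hK
  have hK1 : 1 ≤ K := by linarith
  refine ⟨(1 + ε) * Real.exp (B * (Real.log K + |Real.log ε|) + 2 * Real.pi * B + ε / 2
    + Real.pi / 4), fun z hz u => ?_⟩
  set R := hankelRadius ε u with hR
  have hεR : ε ≤ R := hankelRadius_ge ε u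
  have hR0 : 0 < R := hε.trans_le hεR
  have hlogK := Real.log_nonneg hK1
  have hlog : |Real.log R| ≤ R / K + Real.log K + |Real.log ε| := by
    rw [abs_le]
    constructor
    · have h1 := Real.log_le_log hε hεR
      have h2 := neg_abs_le (Real.log ε)
      have : 0 ≤ R / K := by positivity
      linarith
    · have h1 := Real.log_le_sub_one_of_pos (show 0 < R / K by positivity)
      rw [Real.log_div hR0.ne' (by positivity)] at h1
      linarith [abs_nonneg (Real.log ε)]
  have hBlog : B * |Real.log R| ≤ R / 8 + B * (Real.log K + |Real.log ε|) := by
    have h1 : B * (R / K) ≤ R / 8 := by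
      rw [hK, ← mul_div_assoc, div_le_div_iff₀ (by positivity) (by norm_num)]
      nlinarith
    nlinarith [mul_le_mul_of_nonneg_left hlog hB]
  have hpow : ‖hankelPow ε z u‖ ≤
      Real.exp (R / 8 + B * (Real.log K + |Real.log ε|) + 2 * Real.pi * B) := by
    rw [hankelPow, Complex.norm_exp]
    refine Real.exp_le_exp.2 ?_
    have hre : (z * ((Real.log (hankelRadius ε u) : ℂ) + Complex.I * (hankelArg u : ℂ))).re =
        z.re * Real.log R - z.im * hankelArg u := by
      simp [hR]
    rw [hre]
    have h1 : z.re * Real.log R ≤ B * |Real.log R| := by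
      refine (le_abs_self _).trans ?_
      rw [abs_mul]
      exact mul_le_mul_of_nonneg_right ((Complex.abs_re_le_norm z).trans hz) (abs_nonneg _)
    have h2 : -(z.im * hankelArg u) ≤ B * (2 * Real.pi) := by
      refine (neg_le_abs _).trans ?_
      rw [abs_mul, abs_of_nonneg (hankelArg_mem u).1]
      exact mul_le_mul ((Complex.abs_im_le_norm z).trans hz) (hankelArg_mem u).2
        (hankelArg_mem u).1 hB
    linarith
  rw [norm_mul]
  calc _ ≤ Real.exp (R / 8 + B * (Real.log K + |Real.log ε|) + 2 * Real.pi * B) * (1 + ε) *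
        Real.exp (-(R - 2 * ε) / 4) := by
        refine mul_le_mul (mul_le_mul hpow (norm_hankelVel_le hε u) (norm_nonneg _)
          (Real.exp_pos _).le) (Real.exp_le_exp.2 ?_) (Real.exp_pos _).le (by positivity)
        linarith [hankelPath_re_ge hε u]
    _ = (1 + ε) * Real.exp (R / 8 + B * (Real.log K + |Real.log ε|) + 2 * Real.pi * B +
        -(R - 2 * ε) / 4) := by rw [Real.exp_add _ (-(R - 2 * ε) / 4)]; ring
    _ ≤ _ := by
        rw [mul_assoc (1 + ε), ← Real.exp_add]
        refine mul_le_mul_of_nonneg_left (Real.exp_le_exp.2 ?_) (by positivity)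
        linarith [abs_sub_le_hankelRadius hε.le u]

/-- The factor `Γ(1-s) e^{-πis} / (2πi)`, which is `1 / ((e^{2πis} - 1) Γ(s))` for `s ∉ ℤ`. -/
noncomputable def hankelFactor (s : ℂ) : ℂ :=
  Complex.Gamma (1 - s) * Complex.exp (-(Real.pi * Complex.I * s)) / (2 * Real.pi * Complex.I)

/-- The density of the transform `Γ(1-s) e^{-πis} / (2πi) ∫_C f(w+x) x^{s-1} dx`. -/
noncomputable def hankelDensity (ε : ℝ) (s : ℂ) (u : ℝ) : ℂ :=
  hankelFactor s * (hankelPow ε (s - 1) u * hankelVel ε u)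

theorem measurable_hankelDensity (ε : ℝ) (s : ℂ) : Measurable (hankelDensity ε s) :=
  ((measurable_hankelPow ε _).mul (measurable_hankelVel ε)).const_mul _

theorem isDensity_hankelPow_mul {ε : ℝ} (hε : 0 < ε) (z : ℂ) :
    IsDensity (hankelPath ε) fun u => hankelPow ε z u * hankelVel ε u := by
  obtain ⟨C, hC⟩ := exists_norm_hankelPow_mul_le hε (norm_nonneg z)
  exact ⟨(measurable_hankelPow ε z).mul (measurable_hankelVel ε), C, 1 / 8, by norm_num,
    hC z le_rfl⟩

theorem IsDensity.const_mul {p κ : ℝ → ℂ} (h : IsDensity p κ) (c : ℂ) :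
    IsDensity p fun u => c * κ u := by
  obtain ⟨hm, C, b, hb, hC⟩ := h
  refine ⟨hm.const_mul c, ‖c‖ * C, b, hb, fun u => ?_⟩
  rw [norm_mul, mul_assoc, mul_assoc]
  exact mul_le_mul_of_nonneg_left (hC u) (norm_nonneg _)

theorem isDensity_hankelDensity {ε : ℝ} (hε : 0 < ε) (s : ℂ) :
    IsDensity (hankelPath ε) (hankelDensity ε s) :=
  (isDensity_hankelPow_mul hε (s - 1)).const_mul (hankelFactor s)

/-- The restriction `Re s₀ < 1` keeps a neighbourhood away from the poles `1, 2, …` of `Γ(1 - s)`,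
so the normalizing factor is holomorphic and locally bounded. -/
theorem exists_norm_hankelDensity_le {ε : ℝ} (hε : 0 < ε) {s₀ : ℂ} (hs₀ : s₀.re < 1) :
    ∃ ρ > 0, (∀ u, DifferentiableOn ℂ (fun s => hankelDensity ε s u) (Metric.ball s₀ ρ)) ∧
      ∃ C b : ℝ, 0 < b ∧ ∀ s ∈ Metric.ball s₀ ρ, ∀ u, ‖hankelDensity ε s u‖ *
        Real.exp (-(hankelPath ε u).re / 4) ≤ C * Real.exp (-b * |u|) := by
  have hcd : ∀ s : ℂ, s.re < 1 → DifferentiableAt ℂ hankelFactor s := fun s hs => by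
    have hG : DifferentiableAt ℂ (fun s : ℂ => Complex.Gamma (1 - s)) s := by
      refine DifferentiableAt.comp s (Complex.differentiableAt_Gamma _ fun m h => ?_)
        (by fun_prop)
      have := congrArg Complex.re h
      simp at this
      linarith [(Nat.cast_nonneg m : (0 : ℝ) ≤ m)]
    exact (hG.mul (by fun_prop)).div_const _
  have h1 : ∀ᶠ s in 𝓝 s₀, s.re < 1 :=
    (isOpen_lt Complex.continuous_re continuous_const).mem_nhds hs₀
  have h2 : ∀ᶠ s in 𝓝 s₀, ‖hankelFactor s‖ < ‖hankelFactor s₀‖ + 1 :=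
    (hcd s₀ hs₀).continuousAt.norm.eventually_lt_const (by linarith)
  obtain ⟨ρ, hρ, hball⟩ := Metric.eventually_nhds_iff_ball.1 (h1.and h2)
  obtain ⟨C, hC⟩ := exists_norm_hankelPow_mul_le hε
    (show 0 ≤ ‖s₀ - 1‖ + ρ by positivity)
  refine ⟨ρ, hρ, fun u s hs => ?_, (‖hankelFactor s₀‖ + 1) * C, 1 / 8, by norm_num, fun s hs u => ?_⟩
  · refine DifferentiableAt.differentiableWithinAt ((hcd s (hball s hs).1).mul ?_)
    unfold hankelPow
    fun_prop
  · have hs' : ‖s - 1‖ ≤ ‖s₀ - 1‖ + ρ := by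
      have h3 : ‖s - s₀‖ ≤ ρ := (mem_ball_iff_norm.1 hs).le
      calc ‖s - 1‖ = ‖(s₀ - 1) + (s - s₀)‖ := by congr 1; ring
        _ ≤ _ := (norm_add_le _ _).trans (by linarith)
    have h3 := hC _ hs' u
    rw [hankelDensity, norm_mul, mul_assoc, mul_assoc]
    exact mul_le_mul (hball s hs).2.le h3 (by positivity) (by positivity)

/-- The positive real axis in the logarithmic coordinate. -/
noncomputable def rayPath (u : ℝ) : ℂ := Complex.exp u

/-- The density of the transform `Γ(s)⁻¹ ∫_0^∞ f(w+x) x^{s-1} dx` in the logarithmic coordinate. -/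
noncomputable def rayDensity (s : ℂ) (u : ℝ) : ℂ := (Complex.Gamma s)⁻¹ * Complex.exp (s * u)

theorem rayPath_eq (u : ℝ) : rayPath u = (Real.exp u : ℝ) := by simp [rayPath]

theorem isNearRay_rayPath {ε : ℝ} (hε : 0 ≤ ε) : IsNearRay ε rayPath where
  continuous := by unfold rayPath; fun_prop
  re_ge u := by
    rw [rayPath_eq, Complex.ofReal_re]
    linarith [Real.exp_pos u]
  im_le u := by rw [rayPath_eq, Complex.ofReal_im, abs_zero]; exact hε

theorem exists_norm_exp_mul_le {a B : ℝ} (ha : 0 < a) (hB : 0 ≤ B) :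
    ∃ C : ℝ, ∀ s : ℂ, a ≤ s.re → s.re ≤ B → ∀ u : ℝ, ‖Complex.exp (s * u)‖ *
      Real.exp (-(rayPath u).re / 4) ≤ C * Real.exp (-a * |u|) := by
  -- For `u ≥ 0` convexity of the exponential gives `e^u / 4 ≥ (B + a)(u - log K)`: this absorbs the
  -- growth `e^{Bu}` and leaves `e^{-au}`. For `u ≤ 0` the factor `e^{su}` decays by itself.
  set K := 4 * (B + a) with hK
  have hK0 : 0 < K := by positivity
  refine ⟨max 1 (Real.exp ((B + a) * Real.log K)), fun s has hsB u => ?_⟩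
  have hre : (s * (u : ℂ)).re = s.re * u := by simp
  rw [Complex.norm_exp, hre, rayPath_eq, Complex.ofReal_re]
  rcases le_total u 0 with hu | hu
  · calc _ ≤ Real.exp (s.re * u) * 1 := by
          refine mul_le_mul_of_nonneg_left (Real.exp_le_one_iff.2 ?_) (Real.exp_pos _).le
          linarith [Real.exp_pos u]
      _ ≤ Real.exp (-a * |u|) := by
          rw [mul_one, abs_of_nonpos hu]
          exact Real.exp_le_exp.2 (by nlinarith)
      _ ≤ _ := le_mul_of_one_le_left (Real.exp_pos _).le (le_max_left _ _)
  · rw [← Real.exp_add]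
    calc _ ≤ Real.exp ((B + a) * Real.log K + -a * |u|) := by
          rw [abs_of_nonneg hu]
          refine Real.exp_le_exp.2 ?_
          have h1 := Real.add_one_le_exp (u - Real.log K)
          rw [Real.exp_sub, Real.exp_log hK0] at h1
          have h2 : (u - Real.log K) * K ≤ Real.exp u := by
            rw [← le_div_iff₀ hK0]; linarith
          have h3 : s.re * u ≤ B * u := mul_le_mul_of_nonneg_right hsB hu
          rw [hK] at h2
          rw [hK]
          nlinarith
      _ = Real.exp ((B + a) * Real.log K) * Real.exp (-a * |u|) := Real.exp_add _ _
      _ ≤ _ := mul_le_mul_of_nonneg_right (le_max_right _ _) (Real.exp_pos _).le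

theorem measurable_rayDensity (s : ℂ) : Measurable (rayDensity s) := by
  unfold rayDensity; fun_prop

theorem isDensity_exp_mul {s : ℂ} (hs : 0 < s.re) :
    IsDensity rayPath fun u => Complex.exp (s * u) := by
  obtain ⟨C, hC⟩ := exists_norm_exp_mul_le hs hs.le
  exact ⟨by fun_prop, C, s.re, hs, hC s le_rfl le_rfl⟩

theorem isDensity_rayDensity {s : ℂ} (hs : 0 < s.re) : IsDensity rayPath (rayDensity s) :=
  (isDensity_exp_mul hs).const_mul (Complex.Gamma s)⁻¹

theorem exists_norm_rayDensity_le {s₀ : ℂ} (hs₀ : 0 < s₀.re) :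
    ∃ ρ > 0, (∀ u, DifferentiableOn ℂ (fun s => rayDensity s u) (Metric.ball s₀ ρ)) ∧
      ∃ C b : ℝ, 0 < b ∧ ∀ s ∈ Metric.ball s₀ ρ, ∀ u, ‖rayDensity s u‖ *
        Real.exp (-(rayPath u).re / 4) ≤ C * Real.exp (-b * |u|) := by
  have hd : Differentiable ℂ fun s : ℂ => (Complex.Gamma s)⁻¹ :=
    Complex.differentiable_one_div_Gamma
  have h1 : ∀ᶠ s : ℂ in 𝓝 s₀, s₀.re / 2 < s.re :=
    (isOpen_lt continuous_const Complex.continuous_re).mem_nhds (by simp [hs₀])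
  have h3 : ∀ᶠ s : ℂ in 𝓝 s₀, s.re < s₀.re + 1 :=
    (isOpen_lt Complex.continuous_re continuous_const).mem_nhds (by simp)
  have h2 : ∀ᶠ s in 𝓝 s₀, ‖(Complex.Gamma s)⁻¹‖ < ‖(Complex.Gamma s₀)⁻¹‖ + 1 :=
    (hd s₀).continuousAt.norm.eventually_lt_const (by linarith)
  obtain ⟨ρ, hρ, hball⟩ := Metric.eventually_nhds_iff_ball.1 (h1.and (h2.and h3))
  obtain ⟨C, hC⟩ := exists_norm_exp_mul_le (half_pos hs₀)
    (show 0 ≤ s₀.re + 1 by positivity)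
  refine ⟨ρ, hρ, fun u s hs => ?_, (‖(Complex.Gamma s₀)⁻¹‖ + 1) * C, s₀.re / 2, half_pos hs₀,
    fun s hs u => ?_⟩
  · refine DifferentiableAt.differentiableWithinAt ((hd s).mul ?_)
    fun_prop
  · have h4 := hC _ (hball s hs).1.le (hball s hs).2.2.le u
    rw [rayDensity, norm_mul, mul_assoc, mul_assoc]
    exact mul_le_mul (hball s hs).2.1.le h4 (by positivity) (by positivity)

/-! ### Comparison of the Hankel contours with each other and with the positive ray -/

/-- The integrand `f(w + e^z) e^{sz}` in the logarithmic coordinate `z`. -/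
noncomputable def logIntegrand (f : ℂ → ℂ) (w s z : ℂ) : ℂ :=
  f (w + Complex.exp z) * Complex.exp (s * z)

/-- The whole choice of branch is contained here: `f(w + e^z)` has period `2πi`, and `e^{2πis}` is
the monodromy of `x^s`. In the coordinate `z = log x` the contour is the boundary of the half strip
`Re z ≥ log ε`, `0 ≤ Im z ≤ 2π`. -/
theorem logIntegrand_add_two_pi_mul_I (f : ℂ → ℂ) (w s z : ℂ) :
    logIntegrand f w s (z + 2 * Real.pi * Complex.I) =
      Complex.exp (2 * Real.pi * Complex.I * s) * logIntegrand f w s z := by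
  rw [logIntegrand, logIntegrand, Complex.exp_add z, Complex.exp_two_pi_mul_I, mul_add,
    Complex.exp_add (s * z), mul_one, mul_comm s (2 * Real.pi * Complex.I)]
  ring

theorem exp_log_add_mul_I {ε : ℝ} (hε : 0 < ε) (θ : ℝ) :
    Complex.exp (Real.log ε + θ * Complex.I) = ε * Complex.exp (Complex.I * θ) := by
  rw [Complex.exp_add, ← Complex.ofReal_exp, Real.exp_log hε, mul_comm Complex.I]

theorem setIntegral_hankel_Iio {ε : ℝ} (hε : 0 < ε) (f : ℂ → ℂ) (w s : ℂ) :
    ∫ u in Set.Iio 0, f (w + hankelPath ε u) * (hankelPow ε (s - 1) u * hankelVel ε u) =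
      -∫ v in Set.Ioi (Real.log ε), logIntegrand f w s (v : ℝ) := by
  have himg : (fun v : ℝ => ε - Real.exp v) '' Set.Ioi (Real.log ε) = Set.Iio 0 := by
    ext u
    simp only [Set.mem_image, Set.mem_Ioi, Set.mem_Iio]
    constructor
    · rintro ⟨v, hv, rfl⟩
      linarith [(Real.log_lt_iff_lt_exp hε).1 hv]
    · intro hu
      refine ⟨Real.log (ε - u), Real.log_lt_log hε (by linarith), ?_⟩
      rw [Real.exp_log (by linarith)]; ring
  rw [← himg, integral_image_eq_integral_abs_deriv_smul measurableSet_Ioi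
    (f' := fun v => -Real.exp v)
    (fun v _ => ((Real.hasDerivAt_exp v).const_sub ε).hasDerivWithinAt)
    (fun a _ b _ h => Real.exp_injective (by simpa using h)), ← integral_neg]
  refine setIntegral_congr_fun measurableSet_Ioi fun v hv => ?_
  have hu : ε - Real.exp v < 0 := by
    linarith [(Real.log_lt_iff_lt_exp hε).1 hv]
  have e1 : (ε : ℝ) - (ε - Real.exp v) = Real.exp v := by ring
  simp only [hankelPath_of_neg hu, hankelPow, hankelRadius, hankelArg, hankelVel, if_pos hu, e1,
    Real.log_exp, abs_neg, abs_of_pos (Real.exp_pos v), logIntegrand, Complex.real_smul,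
    Complex.ofReal_exp, Complex.ofReal_zero, mul_zero, add_zero]
  have : Complex.exp (s * v) = Complex.exp v * Complex.exp ((s - 1) * v) := by
    rw [← Complex.exp_add]; congr 1; ring
  rw [this]; ring

theorem setIntegral_hankel_Ioi {ε : ℝ} (hε : 0 < ε) (f : ℂ → ℂ) (w s : ℂ) :
    ∫ u in Set.Ioi (2 * Real.pi),
        f (w + hankelPath ε u) * (hankelPow ε (s - 1) u * hankelVel ε u) =
      Complex.exp (2 * Real.pi * Complex.I * s) *
        ∫ v in Set.Ioi (Real.log ε), logIntegrand f w s (v : ℝ) := by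
  have himg : (fun v : ℝ => Real.exp v + (2 * Real.pi - ε)) '' Set.Ioi (Real.log ε) =
      Set.Ioi (2 * Real.pi) := by
    ext u
    simp only [Set.mem_image, Set.mem_Ioi]
    constructor
    · rintro ⟨v, hv, rfl⟩
      linarith [(Real.log_lt_iff_lt_exp hε).1 hv]
    · intro hu
      refine ⟨Real.log (u - (2 * Real.pi - ε)), Real.log_lt_log hε (by linarith), ?_⟩
      rw [Real.exp_log (by linarith)]; ring
  rw [← himg, integral_image_eq_integral_abs_deriv_smul measurableSet_Ioi
    (f' := fun v => Real.exp v)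
    (fun v _ => ((Real.hasDerivAt_exp v).add_const _).hasDerivWithinAt)
    (fun a _ b _ h => Real.exp_injective (by simpa using h)), ← integral_const_mul]
  refine setIntegral_congr_fun measurableSet_Ioi fun v hv => ?_
  have hu : 2 * Real.pi < Real.exp v + (2 * Real.pi - ε) := by
    linarith [(Real.log_lt_iff_lt_exp hε).1 hv]
  have hu0 : ¬ Real.exp v + (2 * Real.pi - ε) < 0 := by linarith [Real.pi_pos]
  have e1 : ε + (Real.exp v + (2 * Real.pi - ε) - 2 * Real.pi) = Real.exp v := by ring
  simp only [hankelPath_of_gt hu, hankelPow, hankelRadius, hankelArg, hankelVel, if_neg hu0,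
    if_neg (not_le.2 hu), e1,
    Real.log_exp, abs_of_pos (Real.exp_pos v), logIntegrand, Complex.real_smul,
    Complex.ofReal_exp, mul_one]
  have : Complex.exp v * Complex.exp ((s - 1) * (v + Complex.I * ((2 * Real.pi : ℝ) : ℂ))) =
      Complex.exp (2 * Real.pi * Complex.I * s) * Complex.exp (s * v) := by
    have e2 : 2 * Real.pi * Complex.I * s + s * v =
        v + (s - 1) * (v + Complex.I * ((2 * Real.pi : ℝ) : ℂ)) + 2 * Real.pi * Complex.I := by
      push_cast; ring
    rw [← Complex.exp_add, ← Complex.exp_add, e2, Complex.exp_add _ (2 * Real.pi * Complex.I),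
      Complex.exp_two_pi_mul_I, mul_one]
  rw [mul_left_comm, this]; ring

theorem setIntegral_hankel_Icc {ε : ℝ} (hε : 0 < ε) (f : ℂ → ℂ) (w s : ℂ) :
    ∫ u in Set.Icc 0 (2 * Real.pi),
        f (w + hankelPath ε u) * (hankelPow ε (s - 1) u * hankelVel ε u) =
      Complex.I * ∫ θ in (0 : ℝ)..2 * Real.pi,
        logIntegrand f w s (Real.log ε + θ * Complex.I) := by
  rw [integral_Icc_eq_integral_Ioc, intervalIntegral.integral_of_le (by positivity),
    ← integral_const_mul]
  refine setIntegral_congr_fun measurableSet_Ioc fun u hu => ?_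
  have h0 : ¬ u < 0 := not_lt.2 hu.1.le
  simp only [hankelPath_of_mem hu.1.le hu.2, hankelPow, hankelRadius, hankelArg, hankelVel,
    if_neg h0, if_pos hu.2, logIntegrand, exp_log_add_mul_I hε]
  have : Complex.exp (s * (Real.log ε + u * Complex.I)) =
      Complex.exp ((s - 1) * (Real.log ε + Complex.I * u)) * (ε * Complex.exp (Complex.I * u)) := by
    rw [← exp_log_add_mul_I hε, ← Complex.exp_add]; congr 1; ring
  rw [this]; ring

/-- The incoming ray contributes `-1` and the outgoing ray `e^{2πis}` times the same integral over
`(log ε, ∞)`; the circle becomes a vertical segment. -/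
theorem pathTransform_hankel {δ ε : ℝ} (hε : 0 < ε) {f : ℂ → ℂ} (hf : IsDecaying δ f) {w : ℂ}
    (hw : w ∈ halfStrip (δ - ε)) (s : ℂ) :
    pathTransform (hankelPath ε) (hankelDensity ε s) f w = hankelFactor s *
      ((Complex.exp (2 * Real.pi * Complex.I * s) - 1) *
          (∫ v in Set.Ioi (Real.log ε), logIntegrand f w s (v : ℝ)) +
        Complex.I * ∫ θ in (0 : ℝ)..2 * Real.pi,
          logIntegrand f w s (Real.log ε + θ * Complex.I)) := by
  have hint := hf.integrable_comp_mul (isNearRay_hankelPath hε)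
    (isDensity_hankelPow_mul hε (s - 1)) hw
  have hpi := Real.pi_pos
  have h1 : pathTransform (hankelPath ε) (hankelDensity ε s) f w = hankelFactor s *
      ∫ u, f (w + hankelPath ε u) * (hankelPow ε (s - 1) u * hankelVel ε u) := by
    rw [← integral_const_mul, pathTransform]
    refine integral_congr_ae (ae_of_all _ fun u => ?_)
    simp only [hankelDensity]; ring
  have hun : Set.Iio (0 : ℝ) ∪ Set.Icc 0 (2 * Real.pi) ∪ Set.Ioi (2 * Real.pi) = Set.univ := by
    rw [Set.Iio_union_Icc_eq_Iic (by positivity), Set.Iic_union_Ioi]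
  rw [h1, ← setIntegral_univ, ← hun, setIntegral_union ?_ measurableSet_Ioi hint.integrableOn
    hint.integrableOn, setIntegral_union ?_ measurableSet_Icc hint.integrableOn
    hint.integrableOn, setIntegral_hankel_Iio hε, setIntegral_hankel_Icc hε,
    setIntegral_hankel_Ioi hε]
  · ring
  · exact Set.disjoint_left.2 fun x hx hx' => absurd hx'.1 (not_le.2 hx)
  · rw [Set.Iio_union_Icc_eq_Iic (by positivity)]
    exact Set.Iic_disjoint_Ioi le_rfl

/-- Cauchy's theorem for the rectangle with corners `a` and `b + 2πi`; the horizontal sides combine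
by quasi-periodicity. The bounds `a, b ≤ log ε` guarantee `|e^z| ≤ ε`, so `w + e^z` stays in the
domain of `f`. -/
theorem logIntegrand_rect {δ ε : ℝ} (hε : 0 < ε) {f : ℂ → ℂ} (hf : IsDecaying δ f) {w : ℂ}
    (hw : w ∈ halfStrip (δ - ε)) (s : ℂ) {a b : ℝ} (ha : a ≤ Real.log ε) (hb : b ≤ Real.log ε) :
    Complex.I * (∫ θ in (0 : ℝ)..2 * Real.pi, logIntegrand f w s (b + θ * Complex.I)) -
      Complex.I * (∫ θ in (0 : ℝ)..2 * Real.pi, logIntegrand f w s (a + θ * Complex.I)) =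
    (Complex.exp (2 * Real.pi * Complex.I * s) - 1) *
      ∫ v in a..b, logIntegrand f w s (v : ℝ) := by
  have hdiff : DifferentiableOn ℂ (logIntegrand f w s) {z | z.re ≤ Real.log ε} := fun z hz => by
    have hmem : w + Complex.exp z ∈ halfStrip δ := by
      have hn : ‖Complex.exp z‖ ≤ ε := by
        rw [Complex.norm_exp, ← Real.le_log_iff_exp_le hε]; exact hz
      have h1 := abs_le.1 ((Complex.abs_re_le_norm _).trans hn)
      simpa using add_mem_halfStrip hw h1.1 ((Complex.abs_im_le_norm _).trans hn)
    have h1 : DifferentiableAt ℂ f (w + Complex.exp z) :=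
      hf.1.differentiableAt ((isOpen_halfStrip δ).mem_nhds hmem)
    have h2 : DifferentiableAt ℂ (fun z => f (w + Complex.exp z)) z :=
      DifferentiableAt.comp z h1 (by fun_prop)
    exact (h2.mul (by fun_prop)).differentiableWithinAt
  obtain ⟨T, hT⟩ : ∃ T : ℝ, T = 2 * Real.pi := ⟨_, rfl⟩
  have hper : ∀ z : ℂ, logIntegrand f w s (z + T * Complex.I) =
      Complex.exp (2 * Real.pi * Complex.I * s) * logIntegrand f w s z := fun z => by
    rw [hT, ← logIntegrand_add_two_pi_mul_I]
    push_cast; rfl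
  have := Complex.integral_boundary_rect_eq_zero_of_differentiableOn (logIntegrand f w s)
    (a : ℂ) (b + T * Complex.I) (hdiff.mono fun z hz => by
      have h1 := (Set.mem_uIcc.1 hz.1)
      simp at h1
      rcases h1 with h | h
      · exact h.2.trans hb
      · exact h.2.trans ha)
  simp only [Complex.ofReal_re, Complex.ofReal_im, Complex.add_re, Complex.add_im, Complex.mul_re,
    Complex.mul_im, Complex.I_re, Complex.I_im, mul_zero, mul_one, zero_mul, sub_zero, add_zero,
    zero_add, Complex.ofReal_zero, smul_eq_mul,
    hper, intervalIntegral.integral_const_mul] at this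
  rw [← hT]
  linear_combination this

theorem factor_identity (s : ℂ) : Complex.exp (-(Real.pi * Complex.I * s)) /
    (2 * Real.pi * Complex.I) * (Complex.exp (2 * Real.pi * Complex.I * s) - 1) =
      Complex.sin (Real.pi * s) / Real.pi := by
  have hpi : (Real.pi : ℂ) ≠ 0 := by exact_mod_cast Real.pi_ne_zero
  have h1 : Complex.exp (2 * Real.pi * Complex.I * s) =
      Complex.exp (Real.pi * s * Complex.I) * Complex.exp (Real.pi * s * Complex.I) := by
    rw [← Complex.exp_add]; congr 1; ring
  have h2 : Complex.exp (-(Real.pi * Complex.I * s)) * Complex.exp (Real.pi * s * Complex.I) = 1 := by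
    rw [← Complex.exp_add, ← Complex.exp_zero]; congr 1; ring
  have h3 : Complex.exp (-(Real.pi * s) * Complex.I) = Complex.exp (-(Real.pi * Complex.I * s)) := by
    congr 1; ring
  rw [Complex.sin, h1, h3]
  generalize Complex.exp (-(Real.pi * Complex.I * s)) = b at *
  generalize Complex.exp (Real.pi * s * Complex.I) = a at *
  field_simp
  linear_combination a * h2 + (a - b) * Complex.I_sq

/-- This is the reflection formula `Γ(s) Γ(1-s) = π / sin(πs)`. -/
theorem hankelFactor_mul {s : ℂ} (hs : ∀ n : ℤ, s ≠ n) :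
    hankelFactor s * (Complex.exp (2 * Real.pi * Complex.I * s) - 1) = (Complex.Gamma s)⁻¹ := by
  have hpi : (Real.pi : ℂ) ≠ 0 := by exact_mod_cast Real.pi_ne_zero
  have hsin : Complex.sin (Real.pi * s) ≠ 0 := by
    rw [Complex.sin_ne_zero_iff]
    intro k hk
    rw [mul_comm] at hk
    exact hs k (mul_right_cancel₀ hpi hk)
  refine eq_inv_of_mul_eq_one_right ?_
  calc Complex.Gamma s * (hankelFactor s * (Complex.exp (2 * Real.pi * Complex.I * s) - 1))
      = (Complex.Gamma s * Complex.Gamma (1 - s)) * (Complex.exp (-(Real.pi * Complex.I * s)) /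
        (2 * Real.pi * Complex.I) * (Complex.exp (2 * Real.pi * Complex.I * s) - 1)) := by
        rw [hankelFactor]; ring
    _ = 1 := by
        rw [factor_identity, Complex.Gamma_mul_Gamma_one_sub]
        field_simp

theorem exp_two_pi_mul_I_mul_ne_one {s : ℂ} (hs : ∀ n : ℤ, s ≠ n) :
    Complex.exp (2 * Real.pi * Complex.I * s) - 1 ≠ 0 := by
  intro h
  obtain ⟨n, hn⟩ := Complex.exp_eq_one_iff.1 (sub_eq_zero.1 h)
  rw [mul_comm] at hn
  exact hs n (mul_right_cancel₀ Complex.two_pi_I_ne_zero hn)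

theorem hankelFactor_eq {s : ℂ} (hs : ∀ n : ℤ, s ≠ n) :
    hankelFactor s =
      1 / ((Complex.exp (2 * Real.pi * Complex.I * s) - 1) * Complex.Gamma s) := by
  rw [one_div, mul_inv, ← hankelFactor_mul hs]
  field_simp [exp_two_pi_mul_I_mul_ne_one hs]

theorem pathTransform_ray (f : ℂ → ℂ) (w s : ℂ) :
    pathTransform rayPath (rayDensity s) f w =
      (Complex.Gamma s)⁻¹ * ∫ v : ℝ, logIntegrand f w s v := by
  rw [pathTransform, ← integral_const_mul]
  refine integral_congr_ae (ae_of_all _ fun v => ?_)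
  simp only [rayPath, rayDensity, logIntegrand]
  ring

section

variable {δ ε : ℝ} {f : ℂ → ℂ} {w s : ℂ}

theorem integrable_logIntegrand (hf : IsDecaying δ f) (hw : w ∈ halfStrip δ) (hs : 0 < s.re) :
    Integrable fun v : ℝ => logIntegrand f w s v :=
  hf.integrable_comp_mul (isNearRay_rayPath le_rfl) (isDensity_exp_mul hs) (by simpa using hw)

theorem integrableOn_logIntegrand (hf : IsDecaying δ f) (hw : w ∈ halfStrip δ) (s : ℂ) (c : ℝ) :
    IntegrableOn (fun v : ℝ => logIntegrand f w s v) (Set.Ioi c) := by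
  -- Away from `-∞` the exponent is irrelevant: with `N` making `Re (s + N) > 0`, one writes `e^{sv}
  -- = e^{-Nv} e^{(s+N)v}`, where the first factor is bounded on `v > c`.
  set N : ℝ := |s.re| + 1 with hN
  have hpos : 0 < (s + N).re := by
    rw [Complex.add_re, Complex.ofReal_re]
    linarith [neg_abs_le s.re]
  have h1 := ((integrable_logIntegrand hf hw hpos).integrableOn (s := Set.Ioi c)).bdd_mul
    (f := fun v : ℝ => Complex.exp (-(N * v : ℝ))) (c := Real.exp (-(N * c)))
    (by fun_prop) (by
      refine (ae_restrict_iff' measurableSet_Ioi).2 (ae_of_all _ fun v hv => ?_)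
      rw [← Complex.ofReal_neg, Complex.norm_exp_ofReal]
      refine Real.exp_le_exp.2 (neg_le_neg (mul_le_mul_of_nonneg_left (le_of_lt hv) ?_))
      positivity)
  refine h1.congr (ae_of_all _ fun v => ?_)
  simp only [logIntegrand]
  rw [mul_left_comm, ← Complex.exp_add]
  congr 2
  push_cast; ring

theorem pathTransform_hankel_eq_of_le {ε' : ℝ} (hε' : 0 < ε') (hle : ε' ≤ ε)
    (hf : IsDecaying δ f) (hw : w ∈ halfStrip (δ - ε)) (s : ℂ) :
    pathTransform (hankelPath ε) (hankelDensity ε s) f w =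
      pathTransform (hankelPath ε') (hankelDensity ε' s) f w := by
  have hε : 0 < ε := hε'.trans_le hle
  have hlog := Real.log_le_log hε' hle
  rw [pathTransform_hankel hε hf hw,
    pathTransform_hankel hε' hf (halfStrip_mono (by linarith) hw)]
  have h1 := logIntegrand_rect hε hf hw s (a := Real.log ε') (b := Real.log ε) hlog le_rfl
  have h2 := intervalIntegral.integral_interval_add_Ioi
    (integrableOn_logIntegrand hf (halfStrip_mono (by linarith) hw) s (Real.log ε'))
    (integrableOn_logIntegrand hf (halfStrip_mono (by linarith) hw) s (Real.log ε))
  rw [← h2]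
  linear_combination hankelFactor s * h1

theorem tendsto_integral_logIntegrand_atBot (hε : 0 < ε) (hf : IsDecaying δ f)
    (hw : w ∈ halfStrip (δ - ε)) (hs : 0 < s.re) :
    Tendsto (fun a : ℝ => ∫ θ in (0 : ℝ)..2 * Real.pi, logIntegrand f w s (a + θ * Complex.I))
      atBot (𝓝 0) := by
  obtain ⟨B, hB⟩ := hf.exists_norm_le
  have hlim : Tendsto (fun a : ℝ => B * (Real.exp (s.re * a) * Real.exp (2 * Real.pi * |s.im|)) *
      |2 * Real.pi - 0|) atBot (𝓝 0) := by
    have : Tendsto (fun a : ℝ => Real.exp (s.re * a)) atBot (𝓝 0) :=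
      Real.tendsto_exp_atBot.comp (tendsto_id.const_mul_atBot hs)
    simpa using (((this.mul_const (Real.exp (2 * Real.pi * |s.im|))).const_mul B).mul_const
      |2 * Real.pi - 0|)
  refine squeeze_zero_norm' ?_ hlim
  filter_upwards [eventually_le_atBot (Real.log ε)] with a ha
  refine intervalIntegral.norm_integral_le_of_norm_le_const fun θ hθ => ?_
  rw [Set.uIoc_of_le (by positivity)] at hθ
  have hn : ‖Complex.exp (a + θ * Complex.I)‖ ≤ ε := by
    rw [Complex.norm_exp]
    simpa using (Real.le_log_iff_exp_le hε).1 ha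
  have h1 := abs_le.1 ((Complex.abs_re_le_norm _).trans hn)
  have hmem := add_mem_halfStrip hw h1.1 ((Complex.abs_im_le_norm _).trans hn)
  rw [sub_add_cancel] at hmem
  rw [logIntegrand, norm_mul, Complex.norm_exp, ← Real.exp_add]
  refine mul_le_mul (hB _ hmem) (Real.exp_le_exp.2 ?_) (Real.exp_pos _).le
    ((norm_nonneg _).trans (hB _ hmem))
  have hre : (s * (a + θ * Complex.I)).re = s.re * a - s.im * θ := by simp
  rw [hre]
  have : -(s.im * θ) ≤ |s.im| * (2 * Real.pi) := by
    refine (neg_le_abs _).trans ?_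
    rw [abs_mul, abs_of_pos hθ.1]
    exact mul_le_mul_of_nonneg_left hθ.2 (abs_nonneg _)
  linarith

/-- Shrinking the circle to `0` is harmless for `Re s > 0`, so the circle integral supplies the
missing piece `(0, ε)` of the ray, with the same factor `e^{2πis} - 1`; that factor and
`hankelFactor s` combine to `1/Γ(s)`. -/
theorem pathTransform_hankel_eq_ray (hε : 0 < ε) (hf : IsDecaying δ f)
    (hw : w ∈ halfStrip (δ - ε)) (hs : 0 < s.re) (hn : ∀ n : ℤ, s ≠ n) :
    pathTransform (hankelPath ε) (hankelDensity ε s) f w =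
      pathTransform rayPath (rayDensity s) f w := by
  have hint := integrable_logIntegrand hf (halfStrip_mono (by linarith) hw) hs (w := w)
  have h1 : Complex.I * (∫ θ in (0 : ℝ)..2 * Real.pi,
      logIntegrand f w s (Real.log ε + θ * Complex.I)) =
      (Complex.exp (2 * Real.pi * Complex.I * s) - 1) *
        ∫ v in Set.Iic (Real.log ε), logIntegrand f w s (v : ℝ) := by
    have h2 := (intervalIntegral_tendsto_integral_Iic (Real.log ε) hint.integrableOn
      tendsto_id).const_mul (Complex.exp (2 * Real.pi * Complex.I * s) - 1)
    have h3 := ((tendsto_integral_logIntegrand_atBot hε hf hw hs).const_mul Complex.I).const_sub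
      (Complex.I * (∫ θ in (0 : ℝ)..2 * Real.pi,
        logIntegrand f w s (Real.log ε + θ * Complex.I)))
    rw [mul_zero, sub_zero] at h3
    refine tendsto_nhds_unique_of_eventuallyEq h3 h2 ?_
    filter_upwards [eventually_le_atBot (Real.log ε)] with a ha
    exact logIntegrand_rect hε hf hw s ha le_rfl
  rw [pathTransform_hankel hε hf hw, pathTransform_ray, h1, ← hankelFactor_mul hn,
    ← intervalIntegral.integral_Iic_add_Ioi hint.integrableOn hint.integrableOn]
  ring

end

/-! ### The generating functions -/

/-- The function `w / (e^w - 1)`, with value `1` at `0`. -/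
noncomputable def bernoulliGen (w : ℂ) : ℂ := (dslope Complex.exp 0 w)⁻¹

/-- The derivative of `w / (e^w - 1)`, which is holomorphic for `|Im w| < 2π`. -/
noncomputable def desFun : ℂ → ℂ := deriv bernoulliGen

/-- The explicit formula for the derivative of `w / (e^w - 1)` at `w ≠ 0`. -/
noncomputable def desFormula (w : ℂ) : ℂ :=
  1 / (Complex.exp w - 1) - w * Complex.exp w / (Complex.exp w - 1) ^ 2

/-- The difference quotient in `c` of `c / (e^{cw} - 1)` between `1` and `c`. -/
noncomputable def desQuotient (c : ℝ) (w : ℂ) : ℂ :=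
  (1 / (Complex.exp w - 1) - c / (Complex.exp (c * w) - 1)) / (1 - c)

theorem exp_sub_one_ne_zero {w : ℂ} (h0 : w ≠ 0) (h : |w.im| < 2 * Real.pi) :
    Complex.exp w - 1 ≠ 0 := by
  intro h1
  obtain ⟨n, hn⟩ := Complex.exp_eq_one_iff.1 (sub_eq_zero.1 h1)
  have him : w.im = n * (2 * Real.pi) := by rw [hn]; simp
  rw [him, abs_mul, abs_of_pos Real.two_pi_pos] at h
  have h2 : |(n : ℝ)| < 1 := by
    by_contra h3
    nlinarith [Real.two_pi_pos, not_lt.1 h3]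
  have h4 : n = 0 := Int.abs_lt_one_iff.1 (by exact_mod_cast h2)
  exact h0 (by rw [hn, h4]; simp)

theorem bernoulliGen_of_ne {w : ℂ} (h0 : w ≠ 0) : bernoulliGen w = w / (Complex.exp w - 1) := by
  rw [bernoulliGen, dslope_of_ne _ h0, slope_def_field, Complex.exp_zero, sub_zero, inv_div]

theorem isOpen_im_lt : IsOpen {w : ℂ | |w.im| < 2 * Real.pi} :=
  isOpen_lt Complex.continuous_im.abs continuous_const

theorem differentiableOn_bernoulliGen :
    DifferentiableOn ℂ bernoulliGen {w : ℂ | |w.im| < 2 * Real.pi} := by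
  have h1 : DifferentiableOn ℂ (dslope Complex.exp 0) Set.univ :=
    (Complex.differentiableOn_dslope univ_mem).2 Complex.differentiable_exp.differentiableOn
  refine (h1.mono (Set.subset_univ _)).inv fun w hw => ?_
  rcases eq_or_ne w 0 with rfl | h0
  · simp [dslope_same]
  · rw [dslope_of_ne _ h0, slope_def_field, Complex.exp_zero, sub_zero]
    exact div_ne_zero (exp_sub_one_ne_zero h0 hw) h0

theorem desFun_of_ne {w : ℂ} (h0 : w ≠ 0) (h : |w.im| < 2 * Real.pi) :
    desFun w = desFormula w := by
  have hne := exp_sub_one_ne_zero h0 h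
  have h1 : HasDerivAt (fun w : ℂ => w / (Complex.exp w - 1))
      ((1 * (Complex.exp w - 1) - w * Complex.exp w) / (Complex.exp w - 1) ^ 2) w :=
    (hasDerivAt_id w).div ((Complex.hasDerivAt_exp w).sub_const 1) hne
  have h2 : bernoulliGen =ᶠ[𝓝 w] fun w : ℂ => w / (Complex.exp w - 1) := by
    filter_upwards [isOpen_ne.mem_nhds h0] with z hz using bernoulliGen_of_ne hz
  rw [desFun, (h1.congr_of_eventuallyEq h2).deriv, desFormula]
  field_simp

theorem measurable_desFun : Measurable desFun := measurable_deriv _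

theorem measurable_desFormula : Measurable desFormula := by unfold desFormula; fun_prop

theorem measurable_desQuotient (c : ℝ) : Measurable (desQuotient c) := by
  unfold desQuotient; fun_prop

theorem differentiableOn_desFun : DifferentiableOn ℂ desFun {w : ℂ | |w.im| < 2 * Real.pi} :=
  differentiableOn_bernoulliGen.deriv isOpen_im_lt

theorem halfStrip_two_subset : halfStrip 2 ⊆ {w : ℂ | |w.im| < 2 * Real.pi} := fun w hw => by
  have h := hw.2
  simp only [Set.mem_ofPred_eq]
  linarith [Real.pi_gt_three]

theorem norm_desFormula_le {w : ℂ} (h1 : 1 ≤ w.re) (h2 : |w.im| ≤ 2) :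
    ‖desFormula w‖ ≤ 10 * Real.exp (-w.re / 2) := by
  set x := w.re with hx
  have hE : 2 ≤ Real.exp x := by linarith [Real.add_one_le_exp x]
  have hn : ‖Complex.exp w‖ = Real.exp x := Complex.norm_exp w
  have hlow : Real.exp x / 2 ≤ ‖Complex.exp w - 1‖ := by
    have := norm_sub_norm_le (Complex.exp w) 1
    rw [hn, norm_one] at this
    linarith
  have hw : ‖w‖ ≤ x + 2 := by
    have := Complex.norm_le_abs_re_add_abs_im w
    rw [← hx, abs_of_nonneg (by linarith : 0 ≤ x)] at this
    linarith
  have hpos : 0 < Real.exp x / 2 := by positivity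
  have hA : ‖1 / (Complex.exp w - 1)‖ ≤ 1 / (Real.exp x / 2) := by
    rw [norm_div, norm_one]
    exact one_div_le_one_div_of_le hpos hlow
  have hB : ‖w * Complex.exp w / (Complex.exp w - 1) ^ 2‖ ≤
      (x + 2) * Real.exp x / (Real.exp x / 2) ^ 2 := by
    rw [norm_div, norm_mul, norm_pow, hn]
    gcongr
  have hexp : Real.exp x = Real.exp (x / 2) * Real.exp (x / 2) := by
    rw [← Real.exp_add]; congr 1; ring
  have hhalf := Real.add_one_le_exp (x / 2)
  have hneg : Real.exp (-x / 2) = (Real.exp (x / 2))⁻¹ := by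
    rw [← Real.exp_neg]; congr 1; ring
  calc _ ≤ _ := norm_sub_le _ _
    _ ≤ 1 / (Real.exp x / 2) + (x + 2) * Real.exp x / (Real.exp x / 2) ^ 2 := add_le_add hA hB
    _ = (4 * x + 10) / Real.exp x := by field_simp; ring
    -- From `e^{x/2} ≥ 1 + x/2`: the right side is at least `10 + 5x`.
    _ ≤ (10 * Real.exp (x / 2)) / Real.exp x := by gcongr; linarith
    _ = _ := by rw [hneg, hexp]; field_simp

theorem exists_norm_desFun_le :
    ∃ M : ℝ, ∀ w ∈ halfStrip 2, ‖desFun w‖ ≤ M * Real.exp (-w.re / 2) := by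
  have hK : IsCompact (Set.Icc (-2 : ℝ) 1 ×ℂ Set.Icc (-2 : ℝ) 2) :=
    isCompact_Icc.reProdIm isCompact_Icc
  have hsub : Set.Icc (-2 : ℝ) 1 ×ℂ Set.Icc (-2 : ℝ) 2 ⊆ {w : ℂ | |w.im| < 2 * Real.pi} :=
    fun w hw => by
      have := abs_le.2 hw.2
      simp only [Set.mem_ofPred_eq]
      linarith [Real.pi_gt_three]
  obtain ⟨M, hM⟩ := hK.exists_bound_of_continuousOn (differentiableOn_desFun.continuousOn.mono hsub)
  refine ⟨max 10 (M * Real.exp (1 / 2)), fun w hw => ?_⟩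
  rcases le_total 1 w.re with h | h
  · have h0 : w ≠ 0 := by rintro rfl; simp at h; linarith
    rw [desFun_of_ne h0 (halfStrip_two_subset hw)]
    exact (norm_desFormula_le h hw.2.le).trans
      (mul_le_mul_of_nonneg_right (le_max_left _ _) (Real.exp_pos _).le)
  · have h1 := hM w ⟨⟨hw.1.le, h⟩, abs_le.1 hw.2.le⟩
    have hM0 : 0 ≤ M := (norm_nonneg _).trans h1
    calc _ ≤ M := h1
      _ ≤ M * (Real.exp (1 / 2) * Real.exp (-w.re / 2)) := by
        refine le_mul_of_one_le_right hM0 ?_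
        rw [← Real.exp_add, Real.one_le_exp_iff]
        linarith
      _ = (M * Real.exp (1 / 2)) * Real.exp (-w.re / 2) := by ring
      _ ≤ _ := mul_le_mul_of_nonneg_right (le_max_right _ _) (Real.exp_pos _).le

/-- A common bound for the generating functions, uniformly for `c` close to `1`. -/
theorem exists_norm_le :
    ∃ M : ℝ, (∀ w ∈ halfStrip 1, ‖desFun w‖ ≤ M * Real.exp (-w.re / 4)) ∧
      (∀ w ∈ halfStrip 1, ‖desFormula w‖ ≤ M * Real.exp (-w.re / 4)) ∧
      ∀ c : ℝ, c ∈ Set.Icc (1 / 2 : ℝ) (3 / 2) → c ≠ 1 → ∀ w ∈ halfStrip 1,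
        ‖desQuotient c w‖ ≤ M * Real.exp (-w.re / 4) := by
  obtain ⟨M, hM⟩ := exists_norm_desFun_le
  have hM0 : 0 ≤ M := by
    have := (norm_nonneg _).trans (hM 0 (by simp [halfStrip]))
    simpa using this
  -- Multipliers up to `3/2` enlarge the strip of width `1`, hence the bound on width `2`;
  -- multipliers down to `1/2` turn the decay rate `1/2` into the rate `1/4` used everywhere.
  have hmem : ∀ w ∈ halfStrip 1, ∀ l ∈ Set.Icc (1 / 2 : ℝ) (3 / 2), (l : ℂ) * w ∈ halfStrip 2 := by
    intro w hw l hl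
    refine ⟨?_, ?_⟩
    · rw [Complex.re_ofReal_mul]; nlinarith [hw.1, hl.1, hl.2]
    · rw [Complex.im_ofReal_mul, abs_mul, abs_of_nonneg (by linarith [hl.1] : 0 ≤ l)]
      nlinarith [hw.2, hl.1, hl.2, abs_nonneg w.im]
  have hle : ∀ w ∈ halfStrip 1, ∀ l ∈ Set.Icc (1 / 2 : ℝ) (3 / 2),
      ‖desFun (l * w)‖ ≤ M * Real.exp (1 / 2) * Real.exp (-w.re / 4) := by
    intro w hw l hl
    refine (hM _ (hmem w hw l hl)).trans ?_
    rw [mul_assoc, ← Real.exp_add, Complex.re_ofReal_mul]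
    refine mul_le_mul_of_nonneg_left (Real.exp_le_exp.2 ?_) hM0
    have h1 := hw.1
    rcases le_total 0 w.re with h | h
    · nlinarith [hl.1]
    · nlinarith [hl.2]
  have hdes : ∀ w ∈ halfStrip 1, ‖desFun w‖ ≤ M * Real.exp (1 / 2) * Real.exp (-w.re / 4) :=
    fun w hw => by simpa using hle w hw 1 (by norm_num)
  refine ⟨M * Real.exp (1 / 2), hdes, fun w hw => ?_, fun c hc hc1 w hw => ?_⟩
  -- At `w = 0` the formula has the value `0` by the convention on division by zero, not the value
  -- of the extension; the same holds for `desQuotient` below.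
  · rcases eq_or_ne w 0 with rfl | h0
    · simp [desFormula]; positivity
    · rw [← desFun_of_ne h0 (halfStrip_two_subset (halfStrip_mono (by norm_num) hw))]
      exact hdes w hw
  · rcases eq_or_ne w 0 with rfl | h0
    · simp [desQuotient]; positivity
    have hc0 : (c : ℂ) ≠ 0 := by
      have : 0 < c := by linarith [hc.1]
      exact_mod_cast this.ne'
    have hc1' : (1 : ℂ) - c ≠ 0 := by
      rw [sub_ne_zero]; exact_mod_cast hc1.symm
    -- Rewritten this way, the pole at `w = 0` is gone: the quotient is a difference quotient of the
    -- holomorphic function `bernoulliGen` between `c w` and `w`, and the mean value inequality on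
    -- that segment applies.
    have hq : desQuotient c w = (bernoulliGen w - bernoulliGen (c * w)) / (w * (1 - c)) := by
      have e1 := exp_sub_one_ne_zero h0
        (halfStrip_two_subset (halfStrip_mono (by norm_num) hw))
      have e2 := exp_sub_one_ne_zero (mul_ne_zero hc0 h0) (halfStrip_two_subset (hmem w hw c hc))
      rw [desQuotient, bernoulliGen_of_ne h0, bernoulliGen_of_ne (mul_ne_zero hc0 h0)]
      generalize Complex.exp (c * w) = E at *
      field_simp
    have hseg : ∀ z ∈ segment ℝ ((c : ℂ) * w) w, ∃ l ∈ Set.Icc (1 / 2 : ℝ) (3 / 2),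
        z = (l : ℂ) * w := by
      rintro z ⟨a, b, ha, hb, hab, rfl⟩
      refine ⟨a * c + b, ⟨by nlinarith [hc.1], by nlinarith [hc.2]⟩, ?_⟩
      simp only [Complex.real_smul]
      push_cast; ring
    have hmv := (convex_segment (𝕜 := ℝ) ((c : ℂ) * w) w).norm_image_sub_le_of_norm_deriv_le
      (𝕜 := ℂ) (f := bernoulliGen) (C := M * Real.exp (1 / 2) * Real.exp (-w.re / 4))
      (fun z hz => by
        obtain ⟨l, hl, rfl⟩ := hseg z hz
        exact differentiableOn_bernoulliGen.differentiableAt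
          (isOpen_im_lt.mem_nhds (halfStrip_two_subset (hmem w hw l hl))))
      (fun z hz => by
        obtain ⟨l, hl, rfl⟩ := hseg z hz
        exact hle w hw l hl) (left_mem_segment ℝ _ _) (right_mem_segment ℝ _ _)
    rw [hq, norm_div, div_le_iff₀ (norm_pos_iff.2 (mul_ne_zero h0 hc1'))]
    refine hmv.trans (le_of_eq ?_)
    congr 2
    ring

theorem isDecaying_desFun : IsDecaying 1 desFun := by
  obtain ⟨M, hM, -⟩ := exists_norm_le
  exact ⟨differentiableOn_desFun.mono
    ((halfStrip_mono (by norm_num)).trans halfStrip_two_subset), M, hM⟩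

theorem tendsto_desQuotient {w : ℂ} (hw : w ∈ halfStrip 1) :
    Tendsto (fun c : ℝ => desQuotient c w) (𝓝[≠] 1) (𝓝 (desFormula w)) := by
  -- At `w = 0` all values involved are `0` by the convention on division by zero.
  rcases eq_or_ne w 0 with rfl | h0
  · simp [desQuotient, desFormula]
  have hne := exp_sub_one_ne_zero h0 (halfStrip_two_subset (halfStrip_mono (by norm_num) hw))
  have hd : HasDerivAt (fun c : ℂ => c / (Complex.exp (c * w) - 1))
      ((1 * (Complex.exp (1 * w) - 1) - 1 * (Complex.exp (1 * w) * (1 * w))) /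
        (Complex.exp (1 * w) - 1) ^ 2) 1 :=
    (hasDerivAt_id (1 : ℂ)).div
      ((((hasDerivAt_id (1 : ℂ)).mul_const w).cexp).sub_const 1) (by simpa using hne)
  have hd' : HasDerivAt (fun c : ℝ => (c : ℂ) / (Complex.exp (c * w) - 1)) (desFormula w) 1 := by
    have := HasDerivAt.comp_ofReal (z := 1) (by simpa using hd)
    convert this using 1
    rw [desFormula]
    field_simp
  rw [hasDerivAt_iff_tendsto_slope] at hd'
  refine hd'.congr fun c => ?_
  rw [slope_def_module, desQuotient, Complex.real_smul, Complex.ofReal_inv, Complex.ofReal_sub,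
    Complex.ofReal_one, one_mul, ← neg_sub (1 : ℂ) c, inv_neg, div_eq_mul_inv _ ((1 : ℂ) - c)]
  ring

theorem exp_neg_log_add {t : ℝ} (ht : 0 < t) (y : ℂ) :
    Complex.exp (((-Real.log t : ℝ) : ℂ) + y) = 1 / (t : ℂ) * Complex.exp y := by
  rw [Complex.exp_add, ← Complex.ofReal_exp, Real.exp_neg, Real.exp_log ht]
  simp

theorem hatKernel_eq {r : ℕ} {t : ℝ} (ht : 0 < t) (x : Fin r → ℂ) :
    hatKernel r t x = ∏ j, desFormula (((-Real.log t : ℝ) : ℂ) + ∑ k ∈ Finset.Ici j, x k) := by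
  refine Finset.prod_congr rfl fun j _ => ?_
  rw [desFormula, exp_neg_log_add ht]
  push_cast
  ring

theorem desKernel_eq {r : ℕ} (c : ℝ) (x : Fin r → ℂ) :
    1 / (1 - (c : ℂ)) ^ r * desKernel r c x =
      ∏ j, desQuotient c (0 + ∑ k ∈ Finset.Ici j, x k) := by
  simp only [desKernel, desQuotient, zero_add, Finset.prod_div_distrib, Finset.prod_const,
    Finset.card_univ, Fintype.card_fin]
  ring

theorem desLiZero_eq {t : ℝ} (ht : t ∈ Set.Ioo (0 : ℝ) 1) :
    (desLiZero t : ℂ) = desFun ((-Real.log t : ℝ) : ℂ) := by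
  have hlog := Real.log_neg ht.1 ht.2
  have h0 : ((-Real.log t : ℝ) : ℂ) ≠ 0 := by
    rw [Complex.ofReal_ne_zero]; linarith
  have ht0 : (t : ℂ) ≠ 0 := by exact_mod_cast ht.1.ne'
  have ht1 : (1 : ℂ) - t ≠ 0 := by
    rw [sub_ne_zero]; exact_mod_cast ht.2.ne'
  have ht2 : 1 / (t : ℂ) - 1 ≠ 0 := by
    rw [div_sub_one ht0]; exact div_ne_zero ht1 ht0
  have he : Complex.exp ((-Real.log t : ℝ) : ℂ) = 1 / t := by
    simpa using exp_neg_log_add ht.1 0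
  rw [desFun_of_ne h0 (by simp [Real.pi_pos]), desFormula, he, desLiZero]
  have e : (1 : ℂ) / t - 1 = (1 - t) / t := by field_simp
  rw [e]
  push_cast
  field_simp
  ring

/-! ### The transforms at integers -/

/-- The Hankel contour for `Re s < 1`, the positive ray otherwise. -/
noncomputable def mixedPath (ε : ℝ) (s : ℂ) : ℝ → ℂ :=
  if s.re < 1 then hankelPath ε else rayPath

/-- The density belonging to `mixedPath`. -/
noncomputable def mixedDensity (ε : ℝ) (s : ℂ) : ℝ → ℂ :=
  if s.re < 1 then hankelDensity ε s else rayDensity s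

theorem isNearRay_mixedPath {ε : ℝ} (hε : 0 < ε) (s : ℂ) : IsNearRay ε (mixedPath ε s) := by
  unfold mixedPath
  split_ifs
  · exact isNearRay_hankelPath hε
  · exact isNearRay_rayPath hε.le

theorem isDensity_mixedDensity {ε : ℝ} (hε : 0 < ε) (s : ℂ) :
    IsDensity (mixedPath ε s) (mixedDensity ε s) := by
  unfold mixedPath mixedDensity
  split_ifs with h
  · exact isDensity_hankelDensity hε s
  · exact isDensity_rayDensity (by linarith)

theorem exp_two_pi_mul_I_mul_int (n : ℤ) :
    Complex.exp (2 * Real.pi * Complex.I * n) = 1 := by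
  rw [mul_comm]; exact Complex.exp_int_mul_two_pi_mul_I n

/-- From `Γ(2-s) = (1-s) Γ(1-s)` and `e^{πi} = -1`; the factor `s - 1` is the one that integration
by parts produces. -/
theorem hankelFactor_sub_one {s : ℂ} (hs : s ≠ 1) :
    hankelFactor (s - 1) = (s - 1) * hankelFactor s := by
  have h1 : (1 : ℂ) - (s - 1) = (1 - s) + 1 := by ring
  have h2 : -(Real.pi * Complex.I * (s - 1)) =
      -(Real.pi * Complex.I * s) + Real.pi * Complex.I := by ring
  rw [hankelFactor, hankelFactor, h1, Complex.Gamma_add_one _ (sub_ne_zero.2 hs.symm), h2,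
    Complex.exp_add, Complex.exp_pi_mul_I]
  ring

section

variable {δ ε : ℝ} {f : ℂ → ℂ} {w : ℂ}

/-- The infinitesimal form of integration by parts: as `dx = e^z dz`, differentiating `f(w + e^z)`
raises the exponent from `s - 1` to `s`. -/
theorem hasDerivAt_logIntegrand (hf : IsDecaying δ f) (s : ℂ) {z : ℂ}
    (hz : w + Complex.exp z ∈ halfStrip δ) :
    HasDerivAt (logIntegrand f w (s - 1))
      (logIntegrand (deriv f) w s z + (s - 1) * logIntegrand f w (s - 1) z) z := by
  have h1 : HasDerivAt f (deriv f (w + Complex.exp z)) (w + Complex.exp z) :=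
    (hf.1.differentiableAt ((isOpen_halfStrip δ).mem_nhds hz)).hasDerivAt
  have h2 := (h1.comp z ((Complex.hasDerivAt_exp z).const_add w)).mul
    (((hasDerivAt_id z).const_mul (s - 1)).cexp)
  refine h2.congr_deriv ?_
  have : Complex.exp (s * z) = Complex.exp z * Complex.exp ((s - 1) * z) := by
    rw [← Complex.exp_add]; congr 1; ring
  simp only [logIntegrand, this, Function.comp_apply, id]
  ring

theorem mem_halfStrip_of_log (hε : 0 < ε) (hw : w ∈ halfStrip (δ - ε)) (θ : ℝ) :
    w + Complex.exp (Real.log ε + θ * Complex.I) ∈ halfStrip δ := by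
  have hn : ‖Complex.exp (Real.log ε + θ * Complex.I)‖ ≤ ε := by
    rw [Complex.norm_exp]
    simp [Real.exp_log hε]
  have h1 := abs_le.1 ((Complex.abs_re_le_norm _).trans hn)
  simpa using add_mem_halfStrip hw h1.1 ((Complex.abs_im_le_norm _).trans hn)

theorem continuous_logIntegrand_circle (hε : 0 < ε) (hf : IsDecaying δ f)
    (hw : w ∈ halfStrip (δ - ε)) (s : ℂ) :
    Continuous fun θ : ℝ => logIntegrand f w s (Real.log ε + θ * Complex.I) := by
  unfold logIntegrand
  refine Continuous.mul ?_ (by fun_prop)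
  exact hf.1.continuousOn.comp_continuous (by fun_prop) fun θ => mem_halfStrip_of_log hε hw θ

theorem pathTransform_hankel_int (hε : 0 < ε) (hf : IsDecaying δ f)
    (hw : w ∈ halfStrip (δ - ε)) (n : ℤ) :
    pathTransform (hankelPath ε) (hankelDensity ε n) f w = hankelFactor n *
      (Complex.I * ∫ θ in (0 : ℝ)..2 * Real.pi,
        logIntegrand f w n (Real.log ε + θ * Complex.I)) := by
  rw [pathTransform_hankel hε hf hw, exp_two_pi_mul_I_mul_int]
  ring

/-- At integers the two rays cancel and only the circle remains; the primitive in the integration by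
parts is periodic there, so there is no boundary term. -/
theorem pathTransform_hankel_deriv_int (hε : 0 < ε) (hf : IsDecaying δ f)
    (hw : w ∈ halfStrip (δ - ε)) {n : ℤ} (hn : n ≤ 0) :
    pathTransform (hankelPath ε) (hankelDensity ε n) (deriv f) w =
      -pathTransform (hankelPath ε) (hankelDensity ε (n - 1 : ℤ)) f w := by
  obtain ⟨η, hη, hwη⟩ := exists_pos_mem_halfStrip_sub hw
  have hwη' : w ∈ halfStrip (δ - η - ε) := by convert hwη using 2; ring
  have hf' := hf.deriv hη
  rw [pathTransform_hankel_int hε hf' hwη', pathTransform_hankel_int hε hf hw]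
  have hc1 := continuous_logIntegrand_circle hε hf' hwη' (n : ℂ)
  have hc2 := continuous_logIntegrand_circle hε hf hw ((n : ℂ) - 1)
  have key : ∫ θ in (0 : ℝ)..2 * Real.pi,
      Complex.I * (logIntegrand (deriv f) w n (Real.log ε + θ * Complex.I) +
        ((n : ℂ) - 1) * logIntegrand f w ((n : ℂ) - 1) (Real.log ε + θ * Complex.I)) = 0 := by
    rw [intervalIntegral.integral_eq_sub_of_hasDerivAt
      (f := fun θ : ℝ => logIntegrand f w ((n : ℂ) - 1) (Real.log ε + θ * Complex.I))]
    · have := logIntegrand_add_two_pi_mul_I f w ((n - 1 : ℤ) : ℂ) (Real.log ε)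
      rw [exp_two_pi_mul_I_mul_int] at this
      push_cast at this ⊢
      simp [this]
    · intro θ _
      have h1 : HasDerivAt (fun θ : ℝ => (Real.log ε : ℂ) + θ * Complex.I) Complex.I θ := by
        simpa using ((Complex.ofRealCLM.hasDerivAt (x := θ)).mul_const Complex.I).const_add
          (Real.log ε : ℂ)
      have h2 := (hasDerivAt_logIntegrand hf (n : ℂ) (mem_halfStrip_of_log hε hw θ)).scomp θ h1
      exact h2
    · exact Continuous.intervalIntegrable (by fun_prop) _ _
  rw [intervalIntegral.integral_const_mul, intervalIntegral.integral_add
    (hc1.intervalIntegrable _ _) ((hc2.const_mul _).intervalIntegrable _ _),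
    intervalIntegral.integral_const_mul] at key
  have hn1 : (n : ℂ) ≠ 1 := by
    have : n ≠ 1 := by omega
    exact_mod_cast this
  push_cast
  rw [hankelFactor_sub_one hn1]
  linear_combination hankelFactor n * key

/-- For `s = 0` the normalizing factor is `1/(2πi)` and what remains is Cauchy's integral formula on
the circle of radius `ε` around `w`. -/
theorem pathTransform_hankel_zero (hε : 0 < ε) (hf : IsDecaying δ f)
    (hw : w ∈ halfStrip (δ - ε)) :
    pathTransform (hankelPath ε) (hankelDensity ε 0) f w = f w := by
  have h0 := pathTransform_hankel_int hε hf hw 0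
  rw [Int.cast_zero] at h0
  have hsub : Metric.closedBall w ε ⊆ halfStrip δ := fun z hz => by
    have hz' : ‖z - w‖ ≤ ε := mem_closedBall_iff_norm.1 hz
    have h1 := abs_le.1 ((Complex.abs_re_le_norm (z - w)).trans hz')
    simpa using add_mem_halfStrip hw h1.1 ((Complex.abs_im_le_norm (z - w)).trans hz')
  have hcl : DiffContOnCl ℂ f (Metric.ball w ε) :=
    (hf.1.mono hsub).diffContOnCl_ball le_rfl
  have hci := hcl.circleIntegral_sub_inv_smul (Metric.mem_ball_self hε)
  have hcirc : (∮ z in C(w, ε), (z - w)⁻¹ • f z) = Complex.I * ∫ θ in (0 : ℝ)..2 * Real.pi,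
      logIntegrand f w 0 (Real.log ε + θ * Complex.I) := by
    rw [circleIntegral, ← intervalIntegral.integral_const_mul]
    refine intervalIntegral.integral_congr fun θ _ => ?_
    have hne : circleMap 0 ε θ ≠ 0 := by simp [circleMap, hε.ne']
    simp only [deriv_circleMap, circleMap_sub_center, smul_eq_mul, logIntegrand,
      exp_log_add_mul_I hε, zero_mul, Complex.exp_zero, mul_one]
    have e : circleMap w ε θ = w + ε * Complex.exp (Complex.I * θ) := by
      rw [circleMap, mul_comm Complex.I]
    rw [e]
    field_simp
  rw [h0, ← hcirc, hci, hankelFactor]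
  simp only [sub_zero, Complex.Gamma_one, mul_zero, neg_zero, Complex.exp_zero, smul_eq_mul]
  field_simp [Complex.two_pi_I_ne_zero]

theorem exists_norm_logIntegrand_le (hf : IsDecaying δ f) (hw : w ∈ halfStrip δ) {s : ℂ}
    (hs : 0 < s.re) :
    ∃ C : ℝ, ∀ v : ℝ, ‖logIntegrand f w s v‖ ≤ C * Real.exp (-s.re * |v|) := by
  obtain ⟨C, hC⟩ := exists_norm_exp_mul_le hs hs.le
  obtain ⟨M, hM⟩ := hf.2
  refine ⟨M * Real.exp (-w.re / 4) * C, fun v => ?_⟩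
  have h := norm_comp_mul_le (κ := fun u => Complex.exp (s * u)) hM (isNearRay_rayPath le_rfl)
    (hC s le_rfl le_rfl v) (w := w) (by simpa using hw)
  exact h.trans (le_of_eq (by ring))

theorem tendsto_logIntegrand_sub_one_atTop (hf : IsDecaying δ f) (hw : w ∈ halfStrip δ) {s : ℂ}
    (hs : 0 < s.re) :
    Tendsto (fun v : ℝ => logIntegrand f w (s - 1) v) atTop (𝓝 0) := by
  obtain ⟨C, hC⟩ := exists_norm_logIntegrand_le hf hw hs
  have hlim : Tendsto (fun v : ℝ => C * Real.exp (-v)) atTop (𝓝 0) := by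
    simpa using (Real.tendsto_exp_neg_atTop_nhds_zero).const_mul C
  refine squeeze_zero_norm (fun v => ?_) hlim
  have h1 : logIntegrand f w (s - 1) v = logIntegrand f w s v * Complex.exp ((-v : ℝ) : ℂ) := by
    rw [logIntegrand, logIntegrand, mul_assoc, ← Complex.exp_add]
    congr 2; push_cast; ring
  have hC0 : 0 ≤ C := nonneg_of_mul_nonneg_left ((norm_nonneg _).trans (hC 0)) (Real.exp_pos _)
  rw [h1, norm_mul, Complex.norm_exp_ofReal]
  refine mul_le_mul_of_nonneg_right ((hC v).trans ?_) (Real.exp_pos _).le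
  refine mul_le_of_le_one_right hC0 (Real.exp_le_one_iff.2 ?_)
  nlinarith [abs_nonneg v]

theorem tendsto_logIntegrand_atBot (hf : IsDecaying δ f) (hw : w ∈ halfStrip δ) {s : ℂ}
    (hs : 0 < s.re) :
    Tendsto (fun v : ℝ => logIntegrand f w s v) atBot (𝓝 0) := by
  obtain ⟨C, hC⟩ := exists_norm_logIntegrand_le hf hw hs
  have hlim : Tendsto (fun v : ℝ => C * Real.exp (-(s.re * |v|))) atBot (𝓝 0) := by
    simpa using (Real.tendsto_exp_neg_atTop_nhds_zero.comp
      (tendsto_abs_atBot_atTop.const_mul_atTop hs)).const_mul C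
  exact squeeze_zero_norm (fun v => by simpa using hC v) hlim

theorem add_exp_mem_halfStrip (hw : w ∈ halfStrip δ) (v : ℝ) :
    w + Complex.exp v ∈ halfStrip δ := by
  have := (isNearRay_rayPath le_rfl).add_mem (δ := δ) (by simpa using hw) v
  exact this

/-- Integration by parts on the positive ray. The limit `l` is the boundary term at `x = 0`, which
is `f(w)` for `s = 1` and `0` for `Re s > 1`. -/
theorem integral_logIntegrand_deriv (hf : IsDecaying δ f) (hw : w ∈ halfStrip δ) {s l : ℂ}
    (hs : 0 < s.re)
    (hl : Tendsto (fun v : ℝ => logIntegrand f w (s - 1) v) atBot (𝓝 l))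
    (hint : Integrable fun v : ℝ => (s - 1) * logIntegrand f w (s - 1) v) :
    ∫ v : ℝ, logIntegrand (deriv f) w s v =
      -l - ∫ v : ℝ, (s - 1) * logIntegrand f w (s - 1) v := by
  obtain ⟨η, hη, hwη⟩ := exists_pos_mem_halfStrip_sub hw
  have hint' := integrable_logIntegrand (hf.deriv hη) hwη hs
  have key := integral_of_hasDerivAt_of_tendsto
    (f := fun v : ℝ => logIntegrand f w (s - 1) v)
    (f' := fun v : ℝ => logIntegrand (deriv f) w s v + (s - 1) * logIntegrand f w (s - 1) v)
    (fun v => (hasDerivAt_logIntegrand hf s (add_exp_mem_halfStrip hw v)).comp_ofReal)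
    (hint'.add hint) hl (tendsto_logIntegrand_sub_one_atTop hf hw hs)
  rw [integral_add hint' hint] at key
  linear_combination key

/-- The transforms at integers are iterated primitives and derivatives. -/
theorem hasDerivAt_pathTransform_int (hε : 0 < ε) (hf : IsDecaying δ f)
    (hw : w ∈ halfStrip (δ - ε)) (m : ℤ) :
    HasDerivAt (pathTransform (mixedPath ε m) (mixedDensity ε m) f)
      (-pathTransform (mixedPath ε (m - 1 : ℤ)) (mixedDensity ε (m - 1 : ℤ)) f w) w := by
  have h := hf.hasDerivAt_pathTransform (isNearRay_mixedPath hε m)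
    (isDensity_mixedDensity hε m) hw
  convert h using 1
  have hw' : w ∈ halfStrip δ := halfStrip_mono (by linarith) hw
  simp only [mixedPath, mixedDensity, Complex.intCast_re]
  -- For `m ≤ 0` both transforms use the contour, for `m ≥ 2` both use the ray and `Γ(m) = (m-1)
  -- Γ(m-1)` matches the factors. At `m = 1` the two descriptions meet: `∫_0^∞ f'(w + x) dx =
  -- -f(w)`, and `f(w)` is the transform at `0`.
  rcases lt_trichotomy m 1 with hm | rfl | hm
  · have h1 : (m : ℝ) < 1 := by exact_mod_cast hm
    have h2 : ((m - 1 : ℤ) : ℝ) < 1 := by push_cast; linarith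
    rw [if_pos h1, if_pos h1, if_pos h2, if_pos h2,
      pathTransform_hankel_deriv_int hε hf hw (by omega)]
  · have hcont : Tendsto (fun v : ℝ => logIntegrand f w ((1 : ℂ) - 1) v) atBot (𝓝 (f w)) := by
      have h1 : Tendsto (fun v : ℝ => w + Complex.exp v) atBot (𝓝 w) := by
        have : Tendsto (fun v : ℝ => Complex.exp v) atBot (𝓝 0) := by
          have := (Complex.continuous_ofReal.tendsto 0).comp Real.tendsto_exp_atBot
          simpa [Function.comp_def] using this
        simpa using this.const_add w
      have h2 := (hf.1.continuousOn.continuousAt ((isOpen_halfStrip δ).mem_nhds hw')).tendsto.comp h1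
      simpa [logIntegrand, Function.comp_def] using h2
    have key := integral_logIntegrand_deriv hf hw' (s := 1) (by simp) hcont (by simp)
    simp only [Int.cast_one, lt_irrefl, if_false, sub_self, Int.cast_zero, zero_lt_one, if_true]
    rw [pathTransform_hankel_zero hε hf hw, pathTransform_ray, key]
    simp
  · have h1 : ¬ (m : ℝ) < 1 := by rw [not_lt]; exact_mod_cast hm.le
    have h2 : ¬ ((m - 1 : ℤ) : ℝ) < 1 := by
      rw [not_lt]; have : 1 ≤ m - 1 := by omega
      exact_mod_cast this
    have h3 : 0 < ((m : ℂ) - 1).re := by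
      have : (1 : ℝ) < m := by exact_mod_cast hm
      simpa using this
    have hint := (integrable_logIntegrand hf hw' h3).const_mul ((m : ℂ) - 1)
    have key := integral_logIntegrand_deriv hf hw' (s := m) (by simpa using by omega)
      (tendsto_logIntegrand_atBot hf hw' h3) hint
    have h4 : (m : ℂ) - 1 ≠ 0 := fun h => by rw [h] at h3; simp at h3
    have hG : Complex.Gamma m = ((m : ℂ) - 1) * Complex.Gamma ((m : ℂ) - 1) := by
      rw [← Complex.Gamma_add_one _ h4, sub_add_cancel]
    rw [if_neg h1, if_neg h1, if_neg h2, if_neg h2, pathTransform_ray, pathTransform_ray, key,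
      integral_const_mul, hG, mul_inv]
    push_cast
    field_simp
    ring

end

/-! ### The iterated integrals -/

/-- `L(t) = F(-log t)` on `(0,1)`. -/
def RepresentedBy (L : ℝ → ℝ) (F : ℂ → ℂ) : Prop :=
  ∀ t ∈ Set.Ioo (0 : ℝ) 1, (L t : ℂ) = F ((-Real.log t : ℝ) : ℂ)

section

variable {δ : ℝ} {L : ℝ → ℝ} {F F₁ : ℂ → ℂ}

theorem neg_log_mem_halfStrip (hδ : 0 < δ) {t : ℝ} (ht : t ∈ Set.Ioo (0 : ℝ) 1) :
    ((-Real.log t : ℝ) : ℂ) ∈ halfStrip δ :=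
  ofReal_mem_halfStrip hδ (neg_nonneg.2 (Real.log_nonpos ht.1.le ht.2.le))

theorem hasDerivAt_comp_neg_log {F' : ℂ} {t : ℝ} (ht : 0 < t)
    (hF : HasDerivAt F F' ((-Real.log t : ℝ) : ℂ)) :
    HasDerivAt (fun z : ℝ => F ((-Real.log z : ℝ) : ℂ)) (-F' / t) t := by
  have h1 : HasDerivAt (fun z : ℝ => ((-Real.log z : ℝ) : ℂ)) ((-t⁻¹ : ℝ) : ℂ) t :=
    (Real.hasDerivAt_log ht.ne').neg.ofReal_comp
  refine (hF.scomp t h1).congr_deriv ?_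
  rw [smul_eq_mul]; push_cast; ring

theorem IsDecaying.continuousOn_comp_neg_log (hF : IsDecaying δ F) (hδ : 0 < δ) :
    ContinuousOn (fun z : ℝ => F ((-Real.log z : ℝ) : ℂ)) (Set.Ioo 0 1) := fun _ ht =>
  (hasDerivAt_comp_neg_log ht.1 (hF.1.differentiableAt ((isOpen_halfStrip δ).mem_nhds
    (neg_log_mem_halfStrip hδ ht))).hasDerivAt).continuousAt.continuousWithinAt

theorem IsDecaying.exists_norm_comp_neg_log_le (hF : IsDecaying δ F) (hδ : 0 < δ) :
    ∃ M : ℝ, ∀ t ∈ Set.Ioo (0 : ℝ) 1, ‖F ((-Real.log t : ℝ) : ℂ)‖ ≤ M * t ^ (1 / 4 : ℝ) := by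
  obtain ⟨M, hM⟩ := hF.2
  refine ⟨M, fun _ ht => (hM _ (neg_log_mem_halfStrip hδ ht)).trans (le_of_eq ?_)⟩
  rw [Real.rpow_def_of_pos ht.1, Complex.ofReal_re]
  congr 2; ring

theorem RepresentedBy.continuousOn (h : RepresentedBy L F) (hF : IsDecaying δ F) (hδ : 0 < δ) :
    ContinuousOn L (Set.Ioo 0 1) :=
  (Complex.continuous_re.comp_continuousOn (hF.continuousOn_comp_neg_log hδ)).congr
    fun t ht => by simp only [Function.comp_apply]; rw [← h t ht, Complex.ofReal_re]

/-- The decay `e^{-Re w / 4}` reads `t^{1/4}` at `w = -log t`, so after division by `z` the bound is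
`z^{-3/4}`. -/
theorem RepresentedBy.intervalIntegrable (h : RepresentedBy L F) (hF : IsDecaying δ F)
    (hδ : 0 < δ) {t : ℝ} (ht : t ∈ Set.Ioo (0 : ℝ) 1) :
    IntervalIntegrable (fun z => L z / z) volume 0 t := by
  obtain ⟨M, hM⟩ := hF.exists_norm_comp_neg_log_le hδ
  have hsub : Set.Ioc 0 t ⊆ Set.Ioo (0 : ℝ) 1 := fun z hz => ⟨hz.1, hz.2.trans_lt ht.2⟩
  have hr : IntervalIntegrable (fun z : ℝ => M * z ^ (-(3 / 4) : ℝ)) volume 0 t :=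
    (intervalIntegral.intervalIntegrable_rpow' (by norm_num)).const_mul M
  rw [intervalIntegrable_iff_integrableOn_Ioc_of_le ht.1.le] at hr ⊢
  refine hr.mono' ?_ ?_
  · refine ContinuousOn.aestronglyMeasurable ?_ measurableSet_Ioc
    exact ((h.continuousOn hF hδ).mono hsub).div continuousOn_id fun z hz => hz.1.ne'
  · refine (ae_restrict_iff' measurableSet_Ioc).2 (ae_of_all _ fun z hz => ?_)
    have h1 := hM z (hsub hz)
    rw [← h z (hsub hz), Complex.norm_real] at h1
    rw [norm_div, Real.norm_of_nonneg hz.1.le, div_le_iff₀ hz.1, mul_assoc]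
    refine h1.trans (le_of_eq ?_)
    congr 1
    conv_rhs => rw [← Real.rpow_add_one hz.1.ne']
    norm_num

theorem RepresentedBy.hasDerivAt (h : RepresentedBy L F)
    (hd : ∀ w ∈ halfStrip δ, HasDerivAt F (-F₁ w) w) (hδ : 0 < δ) {t : ℝ}
    (ht : t ∈ Set.Ioo (0 : ℝ) 1) :
    DifferentiableAt ℝ L t ∧ ((deriv L t : ℝ) : ℂ) = F₁ ((-Real.log t : ℝ) : ℂ) / t := by
  have h1 := hasDerivAt_comp_neg_log ht.1 (hd _ (neg_log_mem_halfStrip hδ ht))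
  rw [neg_neg] at h1
  have h2 : HasDerivAt (fun z : ℝ => (L z : ℂ)) (F₁ ((-Real.log t : ℝ) : ℂ) / t) t :=
    h1.congr_of_eventuallyEq (by
      filter_upwards [Ioo_mem_nhds ht.1 ht.2] with z hz using h z hz)
  have h3 : HasDerivAt L (F₁ ((-Real.log t : ℝ) : ℂ) / t).re t := by
    exact Complex.reCLM.hasFDerivAt.comp_hasDerivAt t h2
  refine ⟨h3.differentiableAt, ?_⟩
  rw [h3.deriv]
  exact h3.ofReal_comp.unique h2

theorem RepresentedBy.opD (h : RepresentedBy L F)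
    (hd : ∀ w ∈ halfStrip δ, HasDerivAt F (-F₁ w) w) (hδ : 0 < δ) :
    RepresentedBy (opD L) F₁ := fun t ht => by
  have ht0 : (t : ℂ) ≠ 0 := by exact_mod_cast ht.1.ne'
  rw [_root_.opD, Complex.ofReal_mul, (h.hasDerivAt hd hδ ht).2]
  field_simp

/-- The fundamental theorem of calculus on `(0, t)`; the decay of `F₁` makes it vanish at `0`, so
the primitive is the right one. -/
theorem RepresentedBy.opJ (h : RepresentedBy L F) (hF : IsDecaying δ F) (hF₁ : IsDecaying δ F₁)
    (hd : ∀ w ∈ halfStrip δ, HasDerivAt F₁ (-F w) w) (hδ : 0 < δ) :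
    RepresentedBy (opJ L) F₁ := fun t ht => by
  have hsub : ∀ z ∈ Set.Ioo 0 t, z ∈ Set.Ioo (0 : ℝ) 1 := fun z hz => ⟨hz.1, hz.2.trans ht.2⟩
  obtain ⟨M, hM⟩ := hF₁.exists_norm_comp_neg_log_le hδ
  have hzero : Tendsto (fun z : ℝ => F₁ ((-Real.log z : ℝ) : ℂ)) (𝓝[>] 0) (𝓝 0) := by
    have hlim : Tendsto (fun z : ℝ => M * z ^ (1 / 4 : ℝ)) (𝓝[>] 0) (𝓝 0) := by
      have := ((Real.continuousAt_rpow_const 0 (1 / 4) (Or.inr (by norm_num))).tendsto.mono_left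
        (nhdsWithin_le_nhds (s := Set.Ioi 0))).const_mul M
      simpa using this
    refine squeeze_zero_norm' ?_ hlim
    filter_upwards [Ioo_mem_nhdsGT (zero_lt_one (α := ℝ))] with z hz using hM z hz
  have hcont : Tendsto (fun z : ℝ => F₁ ((-Real.log z : ℝ) : ℂ)) (𝓝[<] t)
      (𝓝 (F₁ ((-Real.log t : ℝ) : ℂ))) :=
    ((hF₁.continuousOn_comp_neg_log hδ).continuousAt (Ioo_mem_nhds ht.1 ht.2)).tendsto.mono_left
      nhdsWithin_le_nhds
  have key := intervalIntegral.integral_eq_sub_of_hasDerivAt_of_tendsto ht.1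
    (f := fun z : ℝ => F₁ ((-Real.log z : ℝ) : ℂ)) (f' := fun z : ℝ => ((L z / z : ℝ) : ℂ))
    (fun z hz => by
      have h1 := hasDerivAt_comp_neg_log hz.1 (hd _ (neg_log_mem_halfStrip hδ (hsub z hz)))
      rw [neg_neg, ← h z (hsub z hz)] at h1
      simpa using h1)
    ⟨(h.intervalIntegrable hF hδ ht).1.ofReal, (h.intervalIntegrable hF hδ ht).2.ofReal⟩ hzero hcont
  rw [_root_.opJ, ← intervalIntegral.integral_ofReal, key, sub_zero]

/-- A family of decaying functions linked by `W_m' = -W_{m-1}` is moved up by `J` and down by `D`,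
so `W_0` determines which function each power represents. -/
theorem RepresentedBy.opJPow {W : ℤ → ℂ → ℂ} (h : RepresentedBy L (W 0))
    (hW : ∀ m, IsDecaying δ (W m)) (hd : ∀ m, ∀ w ∈ halfStrip δ, HasDerivAt (W m) (-W (m - 1) w) w)
    (hδ : 0 < δ) (m : ℤ) : RepresentedBy (opJPow m L) (W m) := by
  cases m with
  | ofNat n =>
    induction n with
    | zero => exact h
    | succ n ih =>
      have e : Int.ofNat (n + 1) - 1 = Int.ofNat n := by simp
      have h1 : RepresentedBy (_root_.opJ (_root_.opJPow (Int.ofNat n) L)) (W (Int.ofNat (n + 1))) :=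
        ih.opJ (hW _) (hW _) (fun w hw => e ▸ hd (Int.ofNat (n + 1)) w hw) hδ
      simpa only [_root_.opJPow, Function.iterate_succ_apply'] using h1
  | negSucc n =>
    induction n with
    | zero => exact h.opD (hd 0) hδ
    | succ n ih =>
      have h1 : RepresentedBy (_root_.opD (_root_.opJPow (Int.negSucc n) L)) (W (Int.negSucc n - 1)) :=
        ih.opD (hd _) hδ
      have e : Int.negSucc n - 1 = Int.negSucc (n + 1) := by
        rw [Int.negSucc_eq, Int.negSucc_eq]; push_cast; ring
      rw [e] at h1
      simpa only [_root_.opJPow, Function.iterate_succ_apply'] using h1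

end

/-- The nested integral of `desFun` with the paths `mixedPath`. -/
noncomputable def desNested (ε : ℝ) {r : ℕ} (s : Fin r → ℂ) (a : ℂ) : ℂ :=
  nestedIntegral desFun (fun k => mixedPath ε (s k)) (fun k => mixedDensity ε (s k)) a

section

variable {ε : ℝ} {r : ℕ}

theorem isDecaying_desFun_mul_desNested (hε : 0 < ε) (s : Fin r → ℂ) :
    IsDecaying (1 - r * ε) fun w => desFun w * desNested ε s w :=
  isDecaying_desFun.mul_nestedIntegral hε.le measurable_desFun
    (fun _ => isNearRay_mixedPath hε _) (fun _ => isDensity_mixedDensity hε _)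

theorem pathTransform_mixed_zero {δ : ℝ} {f : ℂ → ℂ} {w : ℂ} (hε : 0 < ε) (hf : IsDecaying δ f)
    (hw : w ∈ halfStrip (δ - ε)) :
    pathTransform (mixedPath ε 0) (mixedDensity ε 0) f w = f w := by
  simp only [mixedPath, mixedDensity, Complex.zero_re, zero_lt_one, if_true]
  exact pathTransform_hankel_zero hε hf hw

theorem desNested_succ (hε : 0 < ε) (s : Fin (r + 1) → ℂ) {a : ℂ}
    (ha : a ∈ halfStrip (1 - (r + 1 : ℕ) * ε)) :
    desNested ε s a = pathTransform (mixedPath ε (s (Fin.last r)))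
      (mixedDensity ε (s (Fin.last r)))
      (fun w => desFun w * desNested ε (fun k => s k.castSucc) w) a :=
  nestedIntegral_succ_eq_pathTransform hε.le measurable_desFun isDecaying_desFun
    (fun _ => isNearRay_mixedPath hε _) (fun _ => isDensity_mixedDensity hε _) ha

theorem representedBy_opJPow {f : ℂ → ℂ} {L : ℝ → ℝ} {δ : ℝ} (hε : 0 < ε) (hf : IsDecaying δ f)
    (hδ : 0 < δ - ε) (h : RepresentedBy L f) (m : ℤ) :
    RepresentedBy (opJPow m L) (pathTransform (mixedPath ε m) (mixedDensity ε m) f) := by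
  refine RepresentedBy.opJPow
    (W := fun m : ℤ => pathTransform (mixedPath ε m) (mixedDensity ε m) f) ?_
    (fun m => hf.pathTransform (isNearRay_mixedPath hε _) (isDensity_mixedDensity hε _))
    (fun m w hw => hasDerivAt_pathTransform_int hε hf hw m) hδ m
  intro t ht
  simp only [Int.cast_zero]
  rw [pathTransform_mixed_zero hε hf (neg_log_mem_halfStrip hδ ht), h t ht]

/-- Both sides obey the same recursion on the last index; the condition on `ε` keeps the strip width
positive at each stage. -/
theorem representedBy_desLi (hε : 0 < ε) (hr : (r + 1) * ε ≤ 1) (k : Fin r → ℤ) :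
    RepresentedBy (desLi r k) (desNested ε fun i => (k i : ℂ)) := by
  induction r with
  | zero => intro t _; simp [desLi, desNested, nestedIntegral_zero]
  | succ r ih =>
    push_cast at hr
    have e : (1 : ℝ) - r * ε - ε = 1 - (r + 1 : ℕ) * ε := by push_cast; ring
    have hδ : 0 < (1 : ℝ) - (r + 1 : ℕ) * ε := by push_cast; linarith
    have h1 : RepresentedBy (fun t => desLiZero t * desLi r (fun i => k i.castSucc) t)
        fun w => desFun w * desNested ε (fun i => (k i.castSucc : ℂ)) w := fun t ht => by
      rw [Complex.ofReal_mul, desLiZero_eq ht, ih (by linarith) (fun i => k i.castSucc) t ht]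
    have h2 := representedBy_opJPow hε (isDecaying_desFun_mul_desNested hε _) (e ▸ hδ) h1
      (k (Fin.last r))
    intro t ht
    rw [desNested_succ hε _ (neg_log_mem_halfStrip hδ ht), ← h2 t ht, desLi]

/-- The case `r = 0` is excluded for a reason: the constant `1` is not integrable against `dz / z`
at `0`. -/
theorem differentiableAt_desLi (hε : 0 < ε) (hr : (r + 1) * ε ≤ 1) (hr1 : 1 ≤ r) (k : Fin r → ℤ)
    {t : ℝ} (ht : t ∈ Set.Ioo (0 : ℝ) 1) :
    DifferentiableAt ℝ (desLi r k) t ∧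
      IntervalIntegrable (fun z => desLi r k z / z) volume 0 t := by
  obtain ⟨r, rfl⟩ : ∃ m, r = m + 1 := ⟨r - 1, by omega⟩
  push_cast at hr
  have e : (1 : ℝ) - r * ε - ε = 1 - (r + 1 : ℕ) * ε := by push_cast; ring
  have hδ : 0 < (1 : ℝ) - (r + 1 : ℕ) * ε := by push_cast; linarith
  set f : ℂ → ℂ := fun w => desFun w * desNested ε (fun i => (k (Fin.castSucc i) : ℂ)) w with hf
  have hfd : IsDecaying (1 - r * ε) f := isDecaying_desFun_mul_desNested hε _
  have hrep : RepresentedBy (desLi (r + 1) k)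
      (pathTransform (mixedPath ε (k (Fin.last r))) (mixedDensity ε (k (Fin.last r))) f) :=
    fun t ht => by
      rw [representedBy_desLi hε (by push_cast; linarith) k t ht,
        desNested_succ hε _ (neg_log_mem_halfStrip hδ ht)]
  refine ⟨(hrep.hasDerivAt (δ := 1 - r * ε - ε)
      (fun w hw => hasDerivAt_pathTransform_int hε hfd hw _) (e ▸ hδ) ht).1, ?_⟩
  exact hrep.intervalIntegrable (hfd.pathTransform (isNearRay_mixedPath hε _)
    (isDensity_mixedDensity hε _)) (e ▸ hδ) ht

end

/-! ### Holomorphy in the exponents -/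

/-- Near every exponent, the transform with the mixed path is given by a path and a density that
depends holomorphically on the exponent, with a uniform bound. -/
theorem exists_local_density {ε : ℝ} (hε : 0 < ε) (s₀ : ℂ) :
    ∃ (p : ℝ → ℂ) (κ : ℂ → ℝ → ℂ) (ρ C b : ℝ), 0 < ρ ∧ 0 < b ∧ IsNearRay ε p ∧
      (∀ u, DifferentiableOn ℂ (fun s => κ s u) (Metric.ball s₀ ρ)) ∧
      (∀ s, Measurable (κ s)) ∧
      (∀ s ∈ Metric.ball s₀ ρ, ∀ u, ‖κ s u‖ * Real.exp (-(p u).re / 4) ≤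
        C * Real.exp (-b * |u|)) ∧
      ∀ s ∈ Metric.ball s₀ ρ, ∀ δ f, IsDecaying δ f → ∀ w ∈ halfStrip (δ - ε),
        pathTransform (mixedPath ε s) (mixedDensity ε s) f w = pathTransform p (κ s) f w := by
  rcases lt_or_ge s₀.re 1 with h | h
  · obtain ⟨ρ, hρ, hd, C, b, hb, hle⟩ := exists_norm_hankelDensity_le hε h
    obtain ⟨ρ', hρ', hre⟩ := Metric.isOpen_iff.1
      (isOpen_lt Complex.continuous_re continuous_const) s₀ h
    have hsub : Metric.ball s₀ (min ρ ρ') ⊆ Metric.ball s₀ ρ :=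
      Metric.ball_subset_ball (min_le_left _ _)
    refine ⟨hankelPath ε, hankelDensity ε, min ρ ρ', C, b, lt_min hρ hρ', hb,
      isNearRay_hankelPath hε, fun u => (hd u).mono hsub, measurable_hankelDensity ε,
      fun s hs => hle s (hsub hs), fun s hs δ f _ w _ => ?_⟩
    have hs1 : s.re < 1 := hre (Metric.ball_subset_ball (min_le_right _ _) hs)
    rw [mixedPath, mixedDensity, if_pos hs1, if_pos hs1]
  · have h0 : 0 < s₀.re := by linarith
    obtain ⟨ρ, hρ, hd, C, b, hb, hle⟩ := exists_norm_rayDensity_le h0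
    obtain ⟨ρ', hρ', hre⟩ := Metric.isOpen_iff.1
      (isOpen_lt continuous_const Complex.continuous_re) s₀ h0
    have hsub : Metric.ball s₀ (min ρ ρ') ⊆ Metric.ball s₀ ρ :=
      Metric.ball_subset_ball (min_le_left _ _)
    refine ⟨rayPath, rayDensity, min ρ ρ', C, b, lt_min hρ hρ', hb,
      isNearRay_rayPath hε.le, fun u => (hd u).mono hsub, measurable_rayDensity,
      fun s hs => hle s (hsub hs), fun s hs δ f hf w hw => ?_⟩
    have hs0 : 0 < s.re := hre (Metric.ball_subset_ball (min_le_right _ _) hs)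
    rw [mixedPath, mixedDensity]
    -- Near a point with `Re s₀ ≥ 1` some exponents have `0 < Re s < 1` and use the contour; these
    -- are not integers, so contour and ray agree.
    split_ifs with h1
    · refine pathTransform_hankel_eq_ray hε hf hw hs0 fun n hn => ?_
      rw [hn, Complex.intCast_re] at hs0 h1
      have h2 : 0 < n := by exact_mod_cast hs0
      have h3 : n < 1 := by exact_mod_cast h1
      omega
    · rfl

theorem mem_halfStrip_of_mul_lt {ε : ℝ} {r : ℕ} (hr : r * ε < 1) {a : ℝ} (ha : 0 ≤ a) :
    (a : ℂ) ∈ halfStrip (1 - r * ε) :=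
  ofReal_mem_halfStrip (by linarith) ha

/-- The mixed densities jump at `Re s = 1`, but the transforms do not. Near a given `s₀` one fixed
path per coordinate, with a density holomorphic in the exponent, gives the same nested integral,
which can be differentiated under the integral sign. -/
theorem differentiable_desNested {ε : ℝ} {r : ℕ} (hε : 0 < ε) {a : ℂ}
    (ha : a ∈ halfStrip (1 - r * ε)) :
    Differentiable ℂ fun s : Fin r → ℂ => desNested ε s a := fun s₀ => by
  choose p κ ρ C b hρ hb hp hd hm hle heq using fun k => exists_local_density hε (s₀ k)
  have hev : ∀ᶠ s in 𝓝 s₀, ∀ k, s k ∈ Metric.ball (s₀ k) (ρ k) :=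
    eventually_all.2 fun k =>
      (continuous_apply k).continuousAt.eventually (Metric.ball_mem_nhds (s₀ k) (hρ k))
  obtain ⟨R, hR, hball⟩ := Metric.eventually_nhds_iff_ball.1 hev
  obtain ⟨M, hM⟩ := isDecaying_desFun.2
  have hdens : ∀ s ∈ Metric.ball s₀ R, ∀ k, IsDensity (p k) (κ k (s k)) := fun s hs k =>
    ⟨hm k _, C k, b k, hb k, hle k _ (hball s hs k)⟩
  have hD : DifferentiableAt ℂ
      (fun s : Fin r → ℂ => nestedIntegral desFun p (fun k => κ k (s k)) a) s₀ := by
    refine differentiableAt_integral_of_norm_le hR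
      (fun s _ => (measurable_nestedIntegrand measurable_desFun
        (fun k => (hp k).continuous.measurable) (fun k => hm k _) a).aestronglyMeasurable)
      (fun s hs u => norm_nestedIntegrand_le hε.le hM hp
        (fun k u => hle k _ (hball s hs k) u) ha u)
      (integrable_prod_exp_neg_mul_abs C hb _) fun u => ?_
    unfold nestedIntegrand
    refine DifferentiableOn.const_mul ?_ _
    have h1 : ∀ k, DifferentiableOn ℂ (fun s : Fin r → ℂ => κ k (s k) (u k)) (Metric.ball s₀ R) :=
      fun k => (hd k (u k)).comp (differentiable_apply k).differentiableOn fun s hs => hball s hs k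
    exact fun s hs => (HasFDerivWithinAt.finsetProd
      fun k _ => (h1 k s hs).hasFDerivWithinAt).differentiableWithinAt
  refine hD.congr_of_eventuallyEq ?_
  filter_upwards [Metric.ball_mem_nhds s₀ hR] with s hs
  exact nestedIntegral_congr hε.le measurable_desFun isDecaying_desFun
    (fun _ => isNearRay_mixedPath hε _) (fun _ => isDensity_mixedDensity hε _) hp
    (hdens s hs) (fun k => heq k _ (hball s hs k)) ha

/-! ### Comparison with the contour integrals -/

/-- The fibre over `z` is countable: each ray meets `z` at most once, and the parameters on the
circle differ by multiples of `2π`. -/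
theorem ae_hankelPath_ne (ε : ℝ) (hε : 0 < ε) (z : ℂ) : ∀ᵐ u, hankelPath ε u ≠ z := by
  have hcirc : {u : ℝ | (ε : ℂ) * Complex.exp (Complex.I * (u : ℂ)) = z}.Countable := by
    rcases Set.eq_empty_or_nonempty {u : ℝ | (ε : ℂ) * Complex.exp (Complex.I * (u : ℂ)) = z} with
      h | ⟨u₀, hu₀⟩
    · rw [h]; exact Set.countable_empty
    · refine (Set.countable_range fun n : ℤ => u₀ + n * (2 * Real.pi)).mono fun u hu => ?_
      have h1 : Complex.exp (Complex.I * u) = Complex.exp (Complex.I * u₀) :=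
        mul_left_cancel₀ (by exact_mod_cast hε.ne') (Eq.trans hu hu₀.symm)
      obtain ⟨n, hn⟩ := Complex.exp_eq_exp_iff_exists_int.1 h1
      refine ⟨n, ?_⟩
      have h2 : Complex.I * (u : ℂ) = Complex.I * ((u₀ + n * (2 * Real.pi) : ℝ) : ℂ) := by
        rw [hn]; push_cast; ring
      exact (Complex.ofReal_injective (mul_left_cancel₀ Complex.I_ne_zero h2)).symm
  have hcount : {u : ℝ | hankelPath ε u = z}.Countable := by
    refine ((hcirc.insert (2 * Real.pi + z.re - ε)).insert (ε - z.re)).mono fun u hu => ?_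
    have hu' : hankelPath ε u = z := hu
    rcases lt_or_ge u 0 with h | h
    · rw [hankelPath_of_neg h] at hu'
      left
      rw [← hu', Complex.ofReal_re]; ring
    · rcases le_or_gt u (2 * Real.pi) with h' | h'
      · rw [hankelPath_of_mem h h'] at hu'
        exact Or.inr (Or.inr hu')
      · rw [hankelPath_of_gt h'] at hu'
        right; left
        rw [← hu', Complex.ofReal_re]; ring
  have := hcount.measure_zero volume
  simpa [ae_iff] using this

section

variable {ε : ℝ} {r : ℕ} {s : Fin r → ℂ}

theorem hankelCoeff_eq (hs : NonIntegral s) : hankelCoeff s = ∏ k, hankelFactor (s k) :=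
  Finset.prod_congr rfl fun k _ => (hankelFactor_eq (hs k)).symm

theorem hankelCoeff_mul_hankelIntegral (hs : NonIntegral s) (ε : ℝ) (G : ℂ → ℂ) (a : ℂ) :
    hankelCoeff s * hankelIntegral (fun x => ∏ j, G (a + ∑ k ∈ Finset.Ici j, x k)) ε s =
      nestedIntegral G (fun _ => hankelPath ε) (fun k => hankelDensity ε (s k)) a := by
  rw [hankelIntegral, ← integral_const_mul, nestedIntegral]
  refine integral_congr_ae (ae_of_all _ fun u => ?_)
  simp only [hankelIntegrand, nestedIntegrand, hankelDensity]
  rw [Finset.prod_mul_distrib (f := fun k => hankelFactor (s k)), hankelCoeff_eq hs]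
  ring

theorem integrable_hankelIntegrand {G : ℂ → ℂ} {M : ℝ} (hε : 0 < ε) (hGm : Measurable G)
    (hG : ∀ w ∈ halfStrip 1, ‖G w‖ ≤ M * Real.exp (-w.re / 4)) (s : Fin r → ℂ) {a : ℂ}
    (ha : a ∈ halfStrip (1 - r * ε)) :
    Integrable (hankelIntegrand (fun x => ∏ j, G (a + ∑ k ∈ Finset.Ici j, x k)) ε s) :=
  integrable_nestedIntegrand hε.le hGm hG (p := fun _ => hankelPath ε)
    (fun _ => isNearRay_hankelPath hε) (fun k => isDensity_hankelPow_mul hε (s k - 1)) ha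

/-- Two replacements at once: the explicit formula by its holomorphic extension, and contours of
radius `ε` by mixed paths of another radius `ε'`. Independence of the small radius is contained in
this. -/
theorem nestedIntegral_desFormula {ε' : ℝ} (hs : NonIntegral s) (hε : 0 < ε) (hε' : 0 < ε') {a : ℝ}
    (ha : 0 ≤ a) (hr : r * ε < 1) (hr' : r * ε' < 1) :
    nestedIntegral desFormula (fun _ => hankelPath ε) (fun k => hankelDensity ε (s k)) a =
      desNested ε' s a := by
  obtain ⟨M, hM1, hM2, -⟩ := exists_norm_le
  rw [← nestedIntegral_congr_left hε.le measurable_desFun hM1 measurable_desFormula hM2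
    (fun _ => isNearRay_hankelPath hε) (fun k => isDensity_hankelDensity hε (s k))
    (fun _ => ae_hankelPath_ne ε hε) (fun w hw h0 => desFun_of_ne h0
      (halfStrip_two_subset (halfStrip_mono (by norm_num) hw))) (mem_halfStrip_of_mul_lt hr ha)]
  have hrm : r * max ε ε' < 1 := by
    rcases max_choice ε ε' with h | h <;> rw [h] <;> assumption
  -- Both families of paths stay within the larger of the two radii, so all transforms are compared
  -- on the strips belonging to it.
  refine nestedIntegral_congr (ε := max ε ε') (hε.le.trans (le_max_left _ _)) measurable_desFun
    isDecaying_desFun (fun _ => (isNearRay_hankelPath hε).mono (le_max_left _ _))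
    (fun k => isDensity_hankelDensity hε (s k))
    (fun _ => (isNearRay_mixedPath hε' _).mono (le_max_right _ _))
    (fun _ => isDensity_mixedDensity hε' _) (fun k δ f hf w hw => ?_)
    (mem_halfStrip_of_mul_lt hrm ha)
  rw [mixedPath, mixedDensity]
  split_ifs with h
  · rcases le_total ε ε' with hle | hle
    · exact (pathTransform_hankel_eq_of_le hε hle hf (by rwa [max_eq_right hle] at hw) _).symm
    · exact pathTransform_hankel_eq_of_le hε' hle hf (by rwa [max_eq_left hle] at hw) _
  · exact pathTransform_hankel_eq_ray hε hf
      (halfStrip_mono (by linarith [le_max_left ε ε']) hw) (by linarith) (hs k)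

theorem hatKernel_eq_fun {t : ℝ} (ht : 0 < t) : hatKernel r t = fun x => ∏ j,
    desFormula (((-Real.log t : ℝ) : ℂ) + ∑ k ∈ Finset.Ici j, x k) :=
  funext fun x => hatKernel_eq ht x

theorem add_sum_mem_halfStrip {x : Fin r → ℂ} (hε : 0 ≤ ε) (hre : ∀ k, -ε ≤ (x k).re)
    (him : ∀ k, |(x k).im| ≤ ε) {a : ℂ} (ha : a ∈ halfStrip (1 - r * ε)) (T : Finset (Fin r)) :
    a + ∑ k ∈ T, x k ∈ halfStrip 1 := by
  have h : ∀ T : Finset (Fin r), a + ∑ k ∈ T, x k ∈ halfStrip (1 - r * ε + T.card * ε) := by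
    intro T
    induction T using Finset.cons_induction with
    | empty => simpa using ha
    | cons k T hk ih =>
      rw [Finset.sum_cons, Finset.card_cons, add_comm (x k), ← add_assoc]
      refine halfStrip_mono (le_of_eq ?_) (add_mem_halfStrip ih (hre k) (him k))
      push_cast; ring
  refine halfStrip_mono ?_ (h T)
  have h1 : (T.card : ℝ) ≤ r := by exact_mod_cast (Finset.card_le_univ T).trans (by simp)
  nlinarith

/-- Dominated convergence, with the bound on `desQuotient` that is uniform for `c` in `[1/2, 3/2]`.
-/
theorem tendsto_nestedIntegral_desQuotient (hε : 0 < ε) (hr : r * ε < 1) (s : Fin r → ℂ) :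
    Tendsto (fun c : ℝ => nestedIntegral (desQuotient c) (fun _ => hankelPath ε)
        (fun k => hankelDensity ε (s k)) 0) (𝓝[≠] 1)
      (𝓝 (nestedIntegral desFormula (fun _ => hankelPath ε)
        (fun k => hankelDensity ε (s k)) 0)) := by
  obtain ⟨M, -, -, hM⟩ := exists_norm_le
  have ha : (0 : ℂ) ∈ halfStrip (1 - r * ε) := by
    simpa using mem_halfStrip_of_mul_lt hr le_rfl
  choose C b hb hle using fun k => (isDensity_hankelDensity hε (s k)).2
  refine tendsto_integral_filter_of_dominated_convergence
    (fun u : Fin r → ℝ => (M * Real.exp (1 / 4)) ^ r * ∏ k, (C k * Real.exp (-b k * |u k|)))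
    (Eventually.of_forall fun c => (measurable_nestedIntegrand (measurable_desQuotient c)
      (fun _ => (continuous_hankelPath ε).measurable)
      (fun k => measurable_hankelDensity ε (s k)) 0).aestronglyMeasurable) ?_
    (integrable_prod_exp_neg_mul_abs C hb _) (ae_of_all _ fun u => ?_)
  · filter_upwards [self_mem_nhdsWithin, nhdsWithin_le_nhds
      (Icc_mem_nhds (show (1 / 2 : ℝ) < 1 by norm_num) (show (1 : ℝ) < 3 / 2 by norm_num))]
      with c hc hc'
    exact ae_of_all _ (norm_nestedIntegrand_le hε.le (hM c hc' hc)
      (fun _ => isNearRay_hankelPath hε) hle ha)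
  · refine Tendsto.mul_const _ (tendsto_finsetProd _ fun j _ => tendsto_desQuotient ?_)
    exact add_sum_mem_halfStrip hε.le (fun k => (isNearRay_hankelPath hε).re_ge _)
      (fun k => (isNearRay_hankelPath hε).im_le _) ha _

end

/-! ### Existence and uniqueness of the continuations -/

theorem mul_lt_one_of_lt {r : ℕ} {ε : ℝ} (hε : ε ∈ Set.Ioo (0 : ℝ) (1 / (r + 1))) :
    r * ε < 1 := by
  have h := (lt_div_iff₀ (by positivity : (0 : ℝ) < r + 1)).1 hε.2
  nlinarith [hε.1]

theorem isHatZetaDes_desNested {r : ℕ} {ε' : ℝ} (hε' : ε' ∈ Set.Ioo (0 : ℝ) (1 / (r + 1))) :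
    IsHatZetaDes r fun t s => desNested ε' s ((-Real.log t : ℝ) : ℂ) := by
  have hlog : ∀ t ∈ Set.Ioo (0 : ℝ) 1, 0 ≤ -Real.log t := fun t ht =>
    neg_nonneg.2 (Real.log_nonpos ht.1.le ht.2.le)
  refine ⟨fun t ht => differentiable_desNested hε'.1
    (mem_halfStrip_of_mul_lt (mul_lt_one_of_lt hε') (hlog t ht)), 1 / (r + 1), by positivity,
    fun ε hε t ht s hs => ?_⟩
  obtain ⟨M, -, hM, -⟩ := exists_norm_le
  have hr := mul_lt_one_of_lt hε
  rw [hatKernel_eq_fun ht.1, hankelCoeff_mul_hankelIntegral hs,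
    nestedIntegral_desFormula hs hε.1 hε'.1 (hlog t ht) hr (mul_lt_one_of_lt hε')]
  exact ⟨integrable_hankelIntegrand hε.1 measurable_desFormula hM s
    (mem_halfStrip_of_mul_lt hr (hlog t ht)), rfl⟩

theorem isZetaDes_desNested {r : ℕ} {ε' : ℝ} (hε' : ε' ∈ Set.Ioo (0 : ℝ) (1 / (r + 1))) :
    IsZetaDes r fun s => desNested ε' s 0 := by
  have hmem : ∀ ε ∈ Set.Ioo (0 : ℝ) (1 / (r + 1)), (0 : ℂ) ∈ halfStrip (1 - r * ε) :=
    fun ε hε => by simpa using mem_halfStrip_of_mul_lt (mul_lt_one_of_lt hε) le_rfl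
  refine ⟨differentiable_desNested hε'.1 (hmem ε' hε'), 1 / (r + 1), by positivity,
    fun ε hε s hs => ⟨?_, ?_⟩⟩
  · obtain ⟨M, -, -, hM⟩ := exists_norm_le
    filter_upwards [self_mem_nhdsWithin, nhdsWithin_le_nhds
      (Icc_mem_nhds (show (1 / 2 : ℝ) < 1 by norm_num) (show (1 : ℝ) < 3 / 2 by norm_num))]
      with c hc hc'
    have h1 := (integrable_hankelIntegrand hε.1 (measurable_desQuotient c) (hM c hc' hc) s
      (hmem ε hε)).const_mul ((1 - (c : ℂ)) ^ r)
    refine h1.congr (ae_of_all _ fun u => ?_)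
    have hc1 : (1 : ℂ) - c ≠ 0 := by
      rw [sub_ne_zero]; exact_mod_cast (Ne.symm hc)
    simp only [hankelIntegrand]
    rw [← desKernel_eq]
    field_simp
  · have h1 := tendsto_nestedIntegral_desQuotient hε.1 (mul_lt_one_of_lt hε) s
    have h2 := nestedIntegral_desFormula hs hε.1 hε'.1 (le_refl (0 : ℝ)) (mul_lt_one_of_lt hε)
      (mul_lt_one_of_lt hε')
    rw [Complex.ofReal_zero] at h2
    rw [h2] at h1
    refine h1.congr fun c => ?_
    rw [← hankelCoeff_mul_hankelIntegral hs, mul_assoc, mul_left_comm]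
    congr 1
    rw [hankelIntegral, hankelIntegral, ← integral_const_mul]
    refine integral_congr_ae (ae_of_all _ fun u => ?_)
    simp only [hankelIntegrand]
    rw [← desKernel_eq, mul_assoc]

/-- Continuity suffices, because integer points are limits of nonintegral ones; no identity theorem
is needed. -/
theorem eq_at_int_of_eq_nonIntegral {r : ℕ} {A B : (Fin r → ℂ) → ℂ} (hA : Continuous A)
    (hB : Continuous B) (h : ∀ s, NonIntegral s → A s = B s) (k : Fin r → ℤ) :
    A (fun i => (k i : ℂ)) = B (fun i => (k i : ℂ)) := by
  -- The shift `1/(2(n+1))` lies in `(0, 1/2]`, so no coordinate is an integer.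
  have hlim : Tendsto (fun n : ℕ => fun i : Fin r => (k i : ℂ) + (1 / ((n : ℝ) + 1) : ℝ) / 2) atTop
      (𝓝 fun i => (k i : ℂ)) := by
    refine tendsto_pi_nhds.2 fun i => ?_
    have h1 := (Complex.continuous_ofReal.tendsto 0).comp
      (tendsto_one_div_add_atTop_nhds_zero_nat (𝕜 := ℝ))
    simpa using (h1.div_const 2).const_add (k i : ℂ)
  refine tendsto_nhds_unique_of_eventuallyEq ((hA.tendsto _).comp hlim) ((hB.tendsto _).comp hlim)
    (Eventually.of_forall fun n => h _ fun i m hm => ?_)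
  have h1 : (k i : ℝ) + 1 / ((n : ℝ) + 1) / 2 = m := by
    have hm' : (k i : ℂ) + (1 / ((n : ℝ) + 1) : ℝ) / 2 = m := hm
    exact_mod_cast hm'
  have h2 : (0 : ℝ) < 1 / ((n : ℝ) + 1) := by positivity
  have h3 : 1 / ((n : ℝ) + 1) ≤ 1 := by
    rw [div_le_one (by positivity)]; linarith [(Nat.cast_nonneg n : (0 : ℝ) ≤ n)]
  have h4 : k i < m := by
    have : (k i : ℝ) < m := by linarith
    exact_mod_cast this
  have h5 : m < k i + 1 := by
    have : (m : ℝ) < k i + 1 := by linarith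
    exact_mod_cast this
  omega

theorem IsHatZetaDes.eq_at_int {r : ℕ} {F F' : ℝ → (Fin r → ℂ) → ℂ} (h : IsHatZetaDes r F)
    (h' : IsHatZetaDes r F') {t : ℝ} (ht : t ∈ Set.Ioo (0 : ℝ) 1) (k : Fin r → ℤ) :
    F t (fun i => (k i : ℂ)) = F' t (fun i => (k i : ℂ)) := by
  obtain ⟨hd, ε₀, hε₀, hF⟩ := h
  obtain ⟨hd', ε₁, hε₁, hF'⟩ := h'
  refine eq_at_int_of_eq_nonIntegral (hd t ht).continuous (hd' t ht).continuous
    (fun s hs => ?_) k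
  have hpos : 0 < min ε₀ ε₁ := lt_min hε₀ hε₁
  rw [(hF (min ε₀ ε₁ / 2) ⟨by linarith, by linarith [min_le_left ε₀ ε₁]⟩ t ht s hs).2,
    (hF' (min ε₀ ε₁ / 2) ⟨by linarith, by linarith [min_le_right ε₀ ε₁]⟩ t ht s hs).2]

theorem IsZetaDes.eq_at_int {r : ℕ} {Z Z' : (Fin r → ℂ) → ℂ} (h : IsZetaDes r Z)
    (h' : IsZetaDes r Z') (k : Fin r → ℤ) :
    Z (fun i => (k i : ℂ)) = Z' (fun i => (k i : ℂ)) := by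
  obtain ⟨hd, ε₀, hε₀, hF⟩ := h
  obtain ⟨hd', ε₁, hε₁, hF'⟩ := h'
  refine eq_at_int_of_eq_nonIntegral hd.continuous hd'.continuous (fun s hs => ?_) k
  have hpos : 0 < min ε₀ ε₁ := lt_min hε₀ hε₁
  exact tendsto_nhds_unique
    (hF (min ε₀ ε₁ / 2) ⟨by linarith, by linarith [min_le_left ε₀ ε₁]⟩ s hs).2
    (hF' (min ε₀ ε₁ / 2) ⟨by linarith, by linarith [min_le_right ε₀ ε₁]⟩ s hs).2

/-- The first two conjuncts and the third one say that the objects are well defined: the entire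
continuations exist, and all functions that occur in the iterated integrals are differentiable on
`(0,1)` and integrable against `dz / z` near `0`. -/
theorem mainTheorem2 (r : ℕ) (hr : 1 ≤ r) :
    IsHatZetaDes r (hatZetaDes r) ∧
    IsZetaDes r (zetaDes r) ∧
    ∀ k : Fin r → ℤ,
      (∀ t ∈ Set.Ioo (0 : ℝ) 1,
        DifferentiableAt ℝ (desLi r k) t ∧
        IntervalIntegrable (fun z => desLi r k z / z) volume 0 t) ∧
      (∀ t ∈ Set.Ioo (0 : ℝ) 1,
        hatZetaDes r t (fun i => (k i : ℂ)) = (desLi r k t : ℂ)) ∧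
      Tendsto (fun t : ℝ => (desLi r k t : ℂ)) (𝓝[<] 1)
        (𝓝 (zetaDes r (fun i => (k i : ℂ)))) := by
  set ε : ℝ := 1 / (r + 1) / 2 with hεdef
  have hr0 : (0 : ℝ) < 1 / (r + 1) := by positivity
  have hε : ε ∈ Set.Ioo (0 : ℝ) (1 / (r + 1)) := ⟨by linarith, by linarith⟩
  have hrε : (r + 1) * ε ≤ 1 := by
    rw [hεdef]; field_simp; norm_num
  -- Existence, witnessed by `desNested`, makes the chosen functions satisfy their specifications;
  -- the `eq_at_int` lemmas then identify their values at integers with those of `desNested`.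
  have hhat : IsHatZetaDes r (hatZetaDes r) :=
    Classical.epsilon_spec ⟨_, isHatZetaDes_desNested hε⟩
  have hzeta : IsZetaDes r (zetaDes r) := Classical.epsilon_spec ⟨_, isZetaDes_desNested hε⟩
  refine ⟨hhat, hzeta, fun k => ⟨fun t ht => differentiableAt_desLi hε.1 hrε hr k ht,
    fun t ht => ?_, ?_⟩⟩
  · rw [hhat.eq_at_int (isHatZetaDes_desNested hε) ht k, representedBy_desLi hε.1 hrε k t ht]
  · rw [hzeta.eq_at_int (isZetaDes_desNested hε) k]
    -- The point `t = 1` corresponds to `a = 0`, which is interior to the half strip.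
    have hcont : ContinuousAt (desNested ε fun i => (k i : ℂ)) 0 :=
      isDecaying_desFun.continuousAt_nestedIntegral hε.1.le measurable_desFun
        (fun _ => isNearRay_mixedPath hε.1 _) (fun _ => isDensity_mixedDensity hε.1 _)
        (by simpa using mem_halfStrip_of_mul_lt (mul_lt_one_of_lt hε) le_rfl)
    have hlog : Tendsto (fun t : ℝ => ((-Real.log t : ℝ) : ℂ)) (𝓝[<] 1) (𝓝 0) := by
      have h1 := ((Real.continuousAt_log one_ne_zero).neg.tendsto).mono_left
        (nhdsWithin_le_nhds (s := Set.Iio 1))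
      simpa [Function.comp_def] using (Complex.continuous_ofReal.tendsto _).comp h1
    refine (hcont.tendsto.comp hlog).congr' ?_
    filter_upwards [Ioo_mem_nhdsLT (zero_lt_one (α := ℝ))] with t ht
    exact (representedBy_desLi hε.1 hrε k t ht).symm
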